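/- For real parameters $q=(u,v,x,y,z)$ with $u>0$, $v>0$, let $L_q=\mathbb Z v_1\oplus\mathbb Z v_2\oplus\mathbb Z v_3\subset\mathbb R^3$ be the Bravais lattice with basis $$v_1=\sqrt C\Big(\tfrac1{\sqrt u},0,0\Big),\quad v_2=\sqrt C\Big(\tfrac{x}{\sqrt u},\tfrac{v}{\sqrt u},0\Big),\quad v_3=\sqrt C\Big(\tfrac{y}{\sqrt u},\tfrac{vz}{\sqrt u},\tfrac{u}{v\sqrt2}\Big),\qquad C=2^{1/3},$$ whose primitive cell has volume $1$; every Bravais lattice of volume $1$ is of this form up to an isometry. For $\alpha>0$ let $f_\alpha(r)=e^{-\alpha r}$ and $$E_{f_\alpha}[L]=\sum_{p\in L\setminus\{0\}}f_\alpha(|p|^2)=\sum_{p\in L\setminus\{0\}}e^{-\alpha|p|^2},$$ and let $D_3$ be the face-centred-cubic lattice, i.e. the parameter $q=(1,1,0,\tfrac12,\tfrac12)$. Critical points and local minimizers or maximizers of $E_{f_\alpha}$ among Bravais lattices of fixed volume $1$ are those of the function $q\mapsto E_{f_\alpha}[L_q]$ of the five real parameters, and a saddle point is a critical point (a point where this function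 is differentiable with zero derivative) that is neither a local minimizer nor a local maximizer. **Proposition.** There exist real numbers $\alpha_0>0$ and $\alpha_1>0$ such that: 1. for every $0<\alpha<\alpha_0$, $D_3$ is a saddle point of $E_{f_\alpha}$ among Bravais lattices of fixed volume $1$; 2. for every $\alpha>\alpha_1$, $D_3$ is a local minimizer of $E_{f_\alpha}$ among Bravais lattices of fixed volume $1$. -/

import Mathlib

noncomputable section

/-- The constant `C = V^{2/3} 2^{1/3}`. -/
def scaleConst (V : ℝ) : ℝ := V ^ (2 / 3 : ℝ) * 2 ^ (1 / 3 : ℝ)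

/-- The basis `v₁, v₂, v₃` of the Bravais lattice of cell volume `V` with parameters
`q = (u, v, x, y, z) = (q 0, q 1, q 2, q 3, q 4)`. -/
def bravaisBasis (V : ℝ) (q : Fin 5 → ℝ) : Fin 3 → EuclideanSpace ℝ (Fin 3) :=
  let u := q 0
  let v := q 1
  let x := q 2
  let y := q 3
  let z := q 4
  ![√(scaleConst V) • !₂[1 / √u, 0, 0],
    √(scaleConst V) • !₂[x / √u, v / √u, 0],
    √(scaleConst V) • !₂[y / √u, v * z / √u, u / (v * √2)]]

/-- The Bravais lattice `ℤ v₁ ⊕ ℤ v₂ ⊕ ℤ v₃ ⊆ ℝ³` of cell volume `V` with parameters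
`q = (u, v, x, y, z)`. -/
def bravaisLattice (V : ℝ) (q : Fin 5 → ℝ) : Submodule ℤ (EuclideanSpace ℝ (Fin 3)) :=
  Submodule.span ℤ (Set.range (bravaisBasis V q))

/-- The admissible parameters `(u, v, x, y, z)`: `u > 0` and `v > 0`. -/
def bravaisDomain : Set (Fin 5 → ℝ) := {q | 0 < q 0 ∧ 0 < q 1}

/-- The energy `E_f[L] = ∑_{p ∈ L ∖ {0}} f(|p|²)`. -/
def latticeEnergy (f : ℝ → ℝ) (L : Submodule ℤ (EuclideanSpace ℝ (Fin 3))) : ℝ :=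
  ∑' p : {p : EuclideanSpace ℝ (Fin 3) // p ∈ L ∧ p ≠ 0}, f (‖p.1‖ ^ 2)

/-- For fixed volume `V`, the energy as a function of the five parameters `(u, v, x, y, z)`. -/
def bravaisEnergy (f : ℝ → ℝ) (V : ℝ) (q : Fin 5 → ℝ) : ℝ :=
  latticeEnergy f (bravaisLattice V q)

/-- The face-centred-cubic lattice `D₃`, as the point `(u, v, x, y, z) = (1, 1, 0, 1/2, 1/2)`. -/
def fccParam : Fin 5 → ℝ := ![1, 1, 0, 1 / 2, 1 / 2]

/-- The potential `f_α(r) = e^{-α r}`. -/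
def gaussPotential (α : ℝ) : ℝ → ℝ := fun r => Real.exp (-α * r)

/-- `q₀` is a critical point of `L ↦ E_f[L]` among Bravais lattices of fixed volume `V`: the
energy is differentiable at `q₀` in the five parameters, with zero derivative. -/
def IsCriticalLattice (f : ℝ → ℝ) (V : ℝ) (q₀ : Fin 5 → ℝ) : Prop :=
  q₀ ∈ bravaisDomain ∧
    HasFDerivAt (bravaisEnergy f V) (0 : (Fin 5 → ℝ) →L[ℝ] ℝ) q₀

/-- `q₀` is a local minimizer of `L ↦ E_f[L]` among Bravais lattices of fixed volume `V`. -/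
def IsLocalMinLattice (f : ℝ → ℝ) (V : ℝ) (q₀ : Fin 5 → ℝ) : Prop :=
  q₀ ∈ bravaisDomain ∧ IsLocalMinOn (bravaisEnergy f V) bravaisDomain q₀

/-- `q₀` is a local maximizer of `L ↦ E_f[L]` among Bravais lattices of fixed volume `V`. -/
def IsLocalMaxLattice (f : ℝ → ℝ) (V : ℝ) (q₀ : Fin 5 → ℝ) : Prop :=
  q₀ ∈ bravaisDomain ∧ IsLocalMaxOn (bravaisEnergy f V) bravaisDomain q₀

/-- `q₀` is a saddle point of `L ↦ E_f[L]` among Bravais lattices of fixed volume `V`: a critical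
point that is neither a local minimizer nor a local maximizer. -/
def IsSaddleLattice (f : ℝ → ℝ) (V : ℝ) (q₀ : Fin 5 → ℝ) : Prop :=
  IsCriticalLattice f V q₀ ∧ ¬ IsLocalMinLattice f V q₀ ∧ ¬ IsLocalMaxLattice f V q₀

end

/-!
Removing the origin, the energy of a lattice is the theta series `∑ exp (-a Q(n))` over `ℤ³` of its
Gram form `Q`, with `a` a fixed multiple of `α` (`bravaisEnergy_eq`). In cubic coordinates the form
of a lattice near `D₃` is `(X² + Y² + Z²) / 2 + h`, where `h` has a small symmetric matrix `S`, and
fixing the volume amounts to `det (1 + 2 S) = 1`, so that `tr S` is of second order in `S`. By cubic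
symmetry the part of the theta series linear in `h` depends on `tr S` only (`tsum_strainForm`).
Hence `D₃` is a critical point for every `α` (`isCriticalLattice_fccParam`).

For large `α`, convexity of the exponential gives a nonnegative second-order remainder, to which
the minimal vectors contribute at least `a² exp (-a) ‖S‖² / 4`, because `D₃` is perfect: a
symmetric matrix is determined by its values on the minimal vectors. The trace term is at most a
constant times `a exp (-a) ‖S‖²`, so `D₃` is a local minimizer (`exists_thetaSum_le`).

For small `α`, Poisson summation along the two-parameter family `(u, v, 0, 1/2, 1/2)` turns the
energy into the theta series, at the large parameter `b = π² / a`, of a form close to that of the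
body-centred-cubic lattice (`thetaSum_eq_mul_thetaSum_dualForm`). That lattice is not perfect:
along the Bain path `v = 1`, `u = 1 ± t` its eight minimal vectors all get longer to second order,
which lowers the theta series when `b` is large (`exists_thetaSum_bain_lt`). Along `u = v` the
minimal vectors split to first order, and convexity of the exponential raises it
(`exists_lt_thetaSum_ortho`). Comparing with the sum of the values at two opposite parameters
removes the terms of first order in both cases. So `D₃` is a saddle point.
-/

open Real Filter Topology

/-! ### Gaussian sums over `ℤ³` -/

/-- The standard quadratic form `n₁² + n₂² + n₃²` on `ℤ³`. -/
noncomputable def intNormSq (n : ℤ × ℤ × ℤ) : ℝ := (n.1 : ℝ) ^ 2 + (n.2.1 : ℝ) ^ 2 + (n.2.2 : ℝ) ^ 2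

theorem summable_exp_neg_mul_int_sq {c : ℝ} (hc : 0 < c) :
    Summable fun n : ℤ => exp (-c * (n : ℝ) ^ 2) := by
  refine (summable_pow_mul_jacobiTheta₂_term_bound 0 (T := c / π) (by positivity) 0).congr
    fun n => ?_
  have := pi_pos.ne'
  simp only [pow_zero, one_mul]
  congr 1
  field_simp
  ring

theorem summable_exp_neg_mul_intNormSq {c : ℝ} (hc : 0 < c) :
    Summable fun n : ℤ × ℤ × ℤ => exp (-c * intNormSq n) := by
  have h := summable_exp_neg_mul_int_sq hc
  have h2 := h.mul_of_nonneg h (fun _ => (exp_pos _).le) (fun _ => (exp_pos _).le)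
  have h3 := h.mul_of_nonneg h2 (fun _ => (exp_pos _).le)
    (fun _ => mul_nonneg (exp_pos _).le (exp_pos _).le)
  refine h3.congr fun n => ?_
  rw [← exp_add, ← exp_add, intNormSq]
  congr 1
  ring

/-- Moments of the Gaussian of a form bounded below by a multiple of the standard one. -/
theorem summable_pow_mul_exp_neg {F : ℤ × ℤ × ℤ → ℝ} {c : ℝ} (hc : 0 < c)
    (hF : ∀ n, c * intNormSq n ≤ F n) (j : ℕ) {a : ℝ} (ha : 0 < a) :
    Summable fun n => F n ^ j * exp (-a * F n) := by
  have h0 : ∀ n, 0 ≤ F n := fun n => le_trans (by unfold intNormSq; positivity) (hF n)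
  refine Summable.of_nonneg_of_le (fun n => mul_nonneg (pow_nonneg (h0 n) j) (exp_pos _).le)
    (fun n => ?_) ((summable_exp_neg_mul_intNormSq (c := a / 2 * c) (by positivity)).mul_left
      (j.factorial * (2 / a) ^ j))
  have h1 : F n ^ j ≤ j.factorial * (2 / a) ^ j * exp (a / 2 * F n) := by
    have h := pow_div_factorial_le_exp (a / 2 * F n) (mul_nonneg (by positivity) (h0 n)) j
    rw [div_le_iff₀ (by positivity), mul_pow] at h
    have h2 : (2 / a) ^ j * (a / 2) ^ j = 1 := by
      rw [← mul_pow]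
      have : 2 / a * (a / 2) = 1 := by field_simp
      rw [this, one_pow]
    calc F n ^ j = (2 / a) ^ j * ((a / 2) ^ j * F n ^ j) := by rw [← mul_assoc, h2, one_mul]
      _ ≤ (2 / a) ^ j * (exp (a / 2 * F n) * j.factorial) := by gcongr
      _ = _ := by ring
  calc F n ^ j * exp (-a * F n)
      ≤ j.factorial * (2 / a) ^ j * exp (a / 2 * F n) * exp (-a * F n) := by gcongr
    _ = j.factorial * (2 / a) ^ j * exp (-(a / 2) * F n) := by
        rw [mul_assoc, ← exp_add]; ring_nf
    _ ≤ _ := by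
        refine mul_le_mul_of_nonneg_left (exp_le_exp.2 ?_) (by positivity)
        have := mul_le_mul_of_nonneg_left (hF n) (show 0 ≤ a / 2 by positivity)
        linarith

theorem summable_exp_neg {F : ℤ × ℤ × ℤ → ℝ} {c : ℝ} (hc : 0 < c)
    (hF : ∀ n, c * intNormSq n ≤ F n) {a : ℝ} (ha : 0 < a) :
    Summable fun n => exp (-a * F n) := by
  simpa using summable_pow_mul_exp_neg hc hF 0 ha

/-! ### The energy as a theta series -/

/-- The squared length of `n₁ v₁ + n₂ v₂ + n₃ v₃`, divided by the scale constant. -/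
noncomputable def bravaisForm (q : Fin 5 → ℝ) (n : ℤ × ℤ × ℤ) : ℝ :=
  ((n.1 + q 2 * n.2.1 + q 3 * n.2.2) ^ 2 + (q 1) ^ 2 * (n.2.1 + q 4 * n.2.2) ^ 2) / q 0
    + (q 0) ^ 2 / (2 * (q 1) ^ 2) * (n.2.2 : ℝ) ^ 2

/-- The lattice vector `n₁ v₁ + n₂ v₂ + n₃ v₃`. -/
noncomputable def bravaisVec (q : Fin 5 → ℝ) (n : ℤ × ℤ × ℤ) : EuclideanSpace ℝ (Fin 3) :=
  n.1 • bravaisBasis 1 q 0 + n.2.1 • bravaisBasis 1 q 1 + n.2.2 • bravaisBasis 1 q 2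

theorem scaleConst_one_pos : 0 < scaleConst 1 := by
  unfold scaleConst
  positivity

theorem norm_bravaisVec_sq {q : Fin 5 → ℝ} (hq : q ∈ bravaisDomain) (n : ℤ × ℤ × ℤ) :
    ‖bravaisVec q n‖ ^ 2 = scaleConst 1 * bravaisForm q n := by
  obtain ⟨h0, h1⟩ := hq
  have hs := sq_sqrt h0.le
  have hC := sq_sqrt scaleConst_one_pos.le
  have h2 : (√2 : ℝ) ^ 2 = 2 := sq_sqrt (by norm_num)
  have hs' : √(q 0) ≠ 0 := (sqrt_pos.2 h0).ne'
  rw [EuclideanSpace.norm_sq_eq, Fin.sum_univ_three]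
  simp only [bravaisVec, bravaisBasis, bravaisForm, ← Int.cast_smul_eq_zsmul ℝ, norm_eq_abs,
    sq_abs, PiLp.add_apply, PiLp.smul_apply, smul_eq_mul, Matrix.cons_val_zero,
    Matrix.cons_val_one, Matrix.cons_val]
  generalize √(scaleConst 1) = r at *
  generalize hw : √(q 0) = w at *
  generalize √(2 : ℝ) = k at *
  rw [← hC, ← hs]
  have hk : k ≠ 0 := by rintro rfl; norm_num at h2
  have := h1.ne'
  field_simp
  rw [h2]
  ring

theorem mem_bravaisLattice_iff {q : Fin 5 → ℝ} {p : EuclideanSpace ℝ (Fin 3)} :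
    p ∈ bravaisLattice 1 q ↔ ∃ n, bravaisVec q n = p := by
  rw [bravaisLattice, Submodule.mem_span_range_iff_exists_fun]
  simp only [Fin.sum_univ_three, bravaisVec]
  constructor
  · rintro ⟨c, h⟩
    exact ⟨(c 0, c 1, c 2), h⟩
  · rintro ⟨n, h⟩
    exact ⟨![n.1, n.2.1, n.2.2], h⟩

theorem bravaisForm_eq_zero {q : Fin 5 → ℝ} (hq : q ∈ bravaisDomain) {n : ℤ × ℤ × ℤ}
    (h : bravaisForm q n = 0) : n = 0 := by
  obtain ⟨h0, h1⟩ := hq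
  unfold bravaisForm at h
  have hA : 0 ≤ ((n.1 + q 2 * n.2.1 + q 3 * n.2.2) ^ 2
    + (q 1) ^ 2 * (n.2.1 + q 4 * n.2.2) ^ 2) / q 0 := by positivity
  have hB : 0 ≤ (q 0) ^ 2 / (2 * (q 1) ^ 2) * (n.2.2 : ℝ) ^ 2 := by positivity
  have hB0 : (q 0) ^ 2 / (2 * (q 1) ^ 2) * (n.2.2 : ℝ) ^ 2 = 0 := by linarith
  have hA0 := (div_eq_zero_iff.1 (by linarith : ((n.1 + q 2 * n.2.1 + q 3 * n.2.2) ^ 2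
    + (q 1) ^ 2 * (n.2.1 + q 4 * n.2.2) ^ 2) / q 0 = 0)).resolve_right h0.ne'
  have e3 : (n.2.2 : ℝ) = 0 := by
    have : (q 0) ^ 2 / (2 * (q 1) ^ 2) ≠ 0 := by positivity
    simpa [this] using hB0
  rw [e3] at hA0
  have e2 : (n.2.1 : ℝ) = 0 := by
    have h3 : (q 1) ^ 2 * (n.2.1 + q 4 * 0) ^ 2 = 0 := by
      nlinarith [sq_nonneg (n.1 + q 2 * n.2.1 + q 3 * 0 : ℝ), sq_nonneg (q 1 * (n.2.1 + q 4 * 0))]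
    simpa [h1.ne'] using h3
  rw [e2] at hA0
  have e1 : (n.1 : ℝ) = 0 := by simpa using hA0
  exact Prod.ext (by exact_mod_cast e1) (Prod.ext (by exact_mod_cast e2) (by exact_mod_cast e3))

theorem bravaisVec_sub (q : Fin 5 → ℝ) (m n : ℤ × ℤ × ℤ) :
    bravaisVec q (m - n) = bravaisVec q m - bravaisVec q n := by
  simp only [bravaisVec, Prod.fst_sub, Prod.snd_sub, sub_smul]
  abel

theorem bravaisVec_eq_zero {q : Fin 5 → ℝ} (hq : q ∈ bravaisDomain) {n : ℤ × ℤ × ℤ} :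
    bravaisVec q n = 0 ↔ n = 0 := by
  constructor
  · intro h
    have h1 := norm_bravaisVec_sq hq n
    rw [h, norm_zero] at h1
    exact bravaisForm_eq_zero hq
      ((mul_eq_zero.1 (h1.symm.trans (by norm_num))).resolve_left scaleConst_one_pos.ne')
  · rintro rfl
    simp [bravaisVec]

theorem bravaisVec_injective {q : Fin 5 → ℝ} (hq : q ∈ bravaisDomain) :
    Function.Injective (bravaisVec q) := fun m n h => by
  rw [← sub_eq_zero, ← bravaisVec_eq_zero hq, bravaisVec_sub, h, sub_self]

/-- The theta series `∑ₙ exp (-a Q(n))` over `ℤ³` of the quadratic form `Q`. -/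
noncomputable def thetaSum (a : ℝ) (Q : ℤ × ℤ × ℤ → ℝ) : ℝ := ∑' n, exp (-a * Q n)

/-- The energy is the theta series of the Gram form with the term of the origin removed. -/
theorem bravaisEnergy_eq {q : Fin 5 → ℝ} (hq : q ∈ bravaisDomain) {α : ℝ}
    (hs : Summable fun n => exp (-(α * scaleConst 1) * bravaisForm q n)) :
    bravaisEnergy (gaussPotential α) 1 q = thetaSum (α * scaleConst 1) (bravaisForm q) - 1 := by
  let e : {n : ℤ × ℤ × ℤ // n ≠ 0} →
      {p : EuclideanSpace ℝ (Fin 3) // p ∈ bravaisLattice 1 q ∧ p ≠ 0} :=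
    fun n => ⟨bravaisVec q n, mem_bravaisLattice_iff.2 ⟨_, rfl⟩,
      fun h => n.2 ((bravaisVec_eq_zero hq).1 h)⟩
  have he : Function.Bijective e := by
    constructor
    · intro m n h
      exact Subtype.ext (bravaisVec_injective hq (Subtype.ext_iff.1 h))
    · rintro ⟨p, hp, hp0⟩
      obtain ⟨n, rfl⟩ := mem_bravaisLattice_iff.1 hp
      exact ⟨⟨n, fun h => hp0 ((bravaisVec_eq_zero hq).2 h)⟩, rfl⟩
  have h1 : bravaisEnergy (gaussPotential α) 1 q =
      ∑' n : {n : ℤ × ℤ × ℤ // n ≠ 0}, exp (-(α * scaleConst 1) * bravaisForm q n) := by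
    rw [bravaisEnergy, latticeEnergy, ← (Equiv.ofBijective e he).tsum_eq]
    refine tsum_congr fun n => ?_
    simp only [Equiv.ofBijective_apply, e, gaussPotential, norm_bravaisVec_sq hq]
    ring_nf
  have h2 := hs.sum_add_tsum_subtype_compl {0}
  rw [thetaSum, h1, ← h2]
  have h3 : bravaisForm q 0 = 0 := by simp [bravaisForm]
  simp only [Finset.sum_singleton, h3, mul_zero, exp_zero, add_sub_cancel_left]
  exact (Equiv.tsum_eq (Equiv.subtypeEquivRight (by simp)) _).symm

/-! ### The face-centred-cubic form and its symmetries -/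

/-- First cubic coordinate of the point of `D₃` with lattice coordinates `n`. In the coordinates
`fccX`, `fccY`, `fccZ` the lattice consists of the integer points with even coordinate sum. -/
noncomputable def fccX (n : ℤ × ℤ × ℤ) : ℝ := n.1 + n.2.1 + n.2.2

/-- Second cubic coordinate of the point of `D₃` with lattice coordinates `n`. -/
noncomputable def fccY (n : ℤ × ℤ × ℤ) : ℝ := n.1 - n.2.1

/-- Third cubic coordinate of the point of `D₃` with lattice coordinates `n`. -/
noncomputable def fccZ (n : ℤ × ℤ × ℤ) : ℝ := n.2.2

/-- The quadratic form of `D₃`, normalised to take the value `1` on minimal vectors. -/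
noncomputable def fccForm (n : ℤ × ℤ × ℤ) : ℝ := (fccX n ^ 2 + fccY n ^ 2 + fccZ n ^ 2) / 2

/-- The quadratic form with symmetric matrix `S` in cubic coordinates, where `s` lists the entries
`S₁₁, S₂₂, S₃₃, S₁₂, S₁₃, S₂₃`. -/
noncomputable def strainForm (s : Fin 6 → ℝ) (n : ℤ × ℤ × ℤ) : ℝ :=
  s 0 * fccX n ^ 2 + s 1 * fccY n ^ 2 + s 2 * fccZ n ^ 2
    + 2 * (s 3 * (fccX n * fccY n) + s 4 * (fccX n * fccZ n) + s 5 * (fccY n * fccZ n))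

/-- The equation `det (1 + 2 S) = 1`, which says that the form `fccForm + strainForm s` has the
same determinant as `fccForm`, solved for the trace of `S`. -/
def IsVolumePreserving (s : Fin 6 → ℝ) : Prop :=
  s 0 + s 1 + s 2 = -2 * (s 0 * s 1 + s 0 * s 2 + s 1 * s 2 - s 3 ^ 2 - s 4 ^ 2 - s 5 ^ 2)
    - 4 * (s 0 * s 1 * s 2 + 2 * (s 3 * s 4 * s 5) - s 0 * s 5 ^ 2 - s 1 * s 4 ^ 2 - s 2 * s 3 ^ 2)

theorem fccForm_ge (n : ℤ × ℤ × ℤ) : 1 / 4 * intNormSq n ≤ fccForm n := by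
  unfold fccForm intNormSq fccX fccY fccZ
  nlinarith [sq_nonneg ((n.1 : ℝ) + 2 / 3 * n.2.2), sq_nonneg ((n.2.1 : ℝ) + 2 / 3 * n.2.2),
    sq_nonneg (n.2.2 : ℝ)]

theorem fccForm_nonneg (n : ℤ × ℤ × ℤ) : 0 ≤ fccForm n := by
  unfold fccForm
  positivity

theorem fccForm_eq_zero_or_one_le (n : ℤ × ℤ × ℤ) : fccForm n = 0 ∨ 1 ≤ fccForm n := by
  have h : fccForm n = ((n.1 ^ 2 + n.2.1 ^ 2 + n.2.2 ^ 2 + n.1 * n.2.2 + n.2.1 * n.2.2 : ℤ) : ℝ) := by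
    unfold fccForm fccX fccY fccZ
    push_cast
    ring
  have h0 := fccForm_nonneg n
  rw [h] at h0 ⊢
  norm_cast at *
  omega

theorem abs_strainForm_le (s : Fin 6 → ℝ) (n : ℤ × ℤ × ℤ) :
    |strainForm s n| ≤ 6 * ‖s‖ * fccForm n := by
  have hs : ∀ i, |s i| ≤ ‖s‖ := fun i => norm_le_pi_norm s i
  have key : ∀ i (w : ℝ), |s i * w| ≤ ‖s‖ * |w| := fun i w => by
    rw [abs_mul]
    exact mul_le_mul_of_nonneg_right (hs i) (abs_nonneg _)
  have hxy : ∀ x y : ℝ, 2 * |x * y| ≤ x ^ 2 + y ^ 2 := fun x y => by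
    rw [abs_mul, ← sq_abs x, ← sq_abs y]
    nlinarith [sq_nonneg (|x| - |y|)]
  have h0 := key 0 (fccX n ^ 2)
  have h1 := key 1 (fccY n ^ 2)
  have h2 := key 2 (fccZ n ^ 2)
  have h3 := key 3 (fccX n * fccY n)
  have h4 := key 4 (fccX n * fccZ n)
  have h5 := key 5 (fccY n * fccZ n)
  simp only [abs_pow, sq_abs] at h0 h1 h2
  have g3 := mul_le_mul_of_nonneg_left (hxy (fccX n) (fccY n)) (norm_nonneg s)
  have g4 := mul_le_mul_of_nonneg_left (hxy (fccX n) (fccZ n)) (norm_nonneg s)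
  have g5 := mul_le_mul_of_nonneg_left (hxy (fccY n) (fccZ n)) (norm_nonneg s)
  unfold strainForm fccForm
  rw [abs_le] at *
  constructor <;> linarith

theorem summable_fccForm_pow (j : ℕ) {a : ℝ} (ha : 0 < a) :
    Summable fun n => fccForm n ^ j * exp (-a * fccForm n) :=
  summable_pow_mul_exp_neg (by norm_num) fccForm_ge j ha

theorem summable_exp_fccForm {a : ℝ} (ha : 0 < a) :
    Summable fun n => exp (-a * fccForm n) := by
  simpa using summable_fccForm_pow 0 ha

theorem summable_mul_exp_fccForm {a : ℝ} (ha : 0 < a) {g : ℤ × ℤ × ℤ → ℝ} {c : ℝ}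
    (hg : ∀ n, |g n| ≤ c * fccForm n) : Summable fun n => g n * exp (-a * fccForm n) := by
  refine Summable.of_norm_bounded ((summable_fccForm_pow 1 ha).mul_left c) fun n => ?_
  rw [norm_mul, norm_eq_abs, norm_eq_abs, abs_exp, pow_one, ← mul_assoc]
  exact mul_le_mul_of_nonneg_right (hg n) (exp_pos _).le

/-- Reflection in `Y = 0`. -/
def fccReflY : Equiv.Perm (ℤ × ℤ × ℤ) :=
  Function.Involutive.toPerm (fun n => (n.2.1, n.1, n.2.2)) fun _ => rfl

/-- Reflection in `Z = 0`. -/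
def fccReflZ : Equiv.Perm (ℤ × ℤ × ℤ) :=
  Function.Involutive.toPerm (fun n => (n.1 + n.2.2, n.2.1 + n.2.2, -n.2.2)) fun n => by simp

/-- Exchange of `X` and `Z`. -/
def fccSwapXZ : Equiv.Perm (ℤ × ℤ × ℤ) :=
  Function.Involutive.toPerm (fun n => (-n.2.1, -n.1, n.1 + n.2.1 + n.2.2)) fun n => by
    refine Prod.ext ?_ (Prod.ext ?_ ?_) <;> simp
    ring

/-- Exchange of `X` and `Y`. -/
def fccSwapXY : Equiv.Perm (ℤ × ℤ × ℤ) :=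
  Function.Involutive.toPerm (fun n => (n.1, -n.2.1 - n.2.2, n.2.2)) fun n => by simp

theorem fcc_reflY (n : ℤ × ℤ × ℤ) : fccX (fccReflY n) = fccX n ∧ fccY (fccReflY n) = -fccY n ∧
    fccZ (fccReflY n) = fccZ n := by
  rw [show fccReflY n = (n.2.1, n.1, n.2.2) from rfl]
  simp only [fccX, fccY, fccZ]
  exact ⟨by ring, by ring, trivial⟩

theorem fcc_reflZ (n : ℤ × ℤ × ℤ) : fccX (fccReflZ n) = fccX n ∧ fccY (fccReflZ n) = fccY n ∧
    fccZ (fccReflZ n) = -fccZ n := by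
  rw [show fccReflZ n = (n.1 + n.2.2, n.2.1 + n.2.2, -n.2.2) from rfl]
  simp only [fccX, fccY, fccZ]
  push_cast
  exact ⟨by ring, by ring, rfl⟩

theorem fcc_swapXZ (n : ℤ × ℤ × ℤ) : fccX (fccSwapXZ n) = fccZ n ∧ fccY (fccSwapXZ n) = fccY n ∧
    fccZ (fccSwapXZ n) = fccX n := by
  rw [show fccSwapXZ n = (-n.2.1, -n.1, n.1 + n.2.1 + n.2.2) from rfl]
  simp only [fccX, fccY, fccZ]
  push_cast
  exact ⟨by ring, by ring, rfl⟩

theorem fcc_swapXY (n : ℤ × ℤ × ℤ) : fccX (fccSwapXY n) = fccY n ∧ fccY (fccSwapXY n) = fccX n ∧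
    fccZ (fccSwapXY n) = fccZ n := by
  rw [show fccSwapXY n = (n.1, -n.2.1 - n.2.2, n.2.2) from rfl]
  simp only [fccX, fccY, fccZ]
  push_cast
  exact ⟨by ring, by ring, trivial⟩

/-- The second moment `∑ X² exp (-a Q)` of the Gaussian on `D₃`. -/
noncomputable def fccMoment (a : ℝ) : ℝ := ∑' n, fccX n ^ 2 * exp (-a * fccForm n)

theorem tsum_fcc_comp (a : ℝ) (g : ℤ × ℤ × ℤ → ℝ) (e : Equiv.Perm (ℤ × ℤ × ℤ))
    (he : ∀ n, fccForm (e n) = fccForm n) :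
    ∑' n, g (e n) * exp (-a * fccForm n) = ∑' n, g n * exp (-a * fccForm n) := by
  rw [← e.tsum_eq fun n => g n * exp (-a * fccForm n)]
  simp only [he]

theorem tsum_fcc_eq_zero (a : ℝ) (g : ℤ × ℤ × ℤ → ℝ) (e : Equiv.Perm (ℤ × ℤ × ℤ))
    (he : ∀ n, fccForm (e n) = fccForm n) (hg : ∀ n, g (e n) = -g n) :
    ∑' n, g n * exp (-a * fccForm n) = 0 := by
  have h := tsum_fcc_comp a g e he
  simp only [hg, neg_mul, tsum_neg] at h
  simp only [neg_mul]
  linarith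

/-- By cubic symmetry the matrix of second moments is scalar, so a strain is felt to first order
through its trace only. -/
theorem tsum_strainForm {a : ℝ} (ha : 0 < a) (s : Fin 6 → ℝ) :
    ∑' n, strainForm s n * exp (-a * fccForm n) = (s 0 + s 1 + s 2) * fccMoment a := by
  have eY : ∀ n, fccForm (fccReflY n) = fccForm n := fun n => by
    obtain ⟨h1, h2, h3⟩ := fcc_reflY n
    simp only [fccForm, h1, h2, h3, neg_sq]
  have eZ : ∀ n, fccForm (fccReflZ n) = fccForm n := fun n => by
    obtain ⟨h1, h2, h3⟩ := fcc_reflZ n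
    simp only [fccForm, h1, h2, h3, neg_sq]
  have eXZ : ∀ n, fccForm (fccSwapXZ n) = fccForm n := fun n => by
    obtain ⟨h1, h2, h3⟩ := fcc_swapXZ n
    simp only [fccForm, h1, h2, h3]
    ring
  have eXY : ∀ n, fccForm (fccSwapXY n) = fccForm n := fun n => by
    obtain ⟨h1, h2, h3⟩ := fcc_swapXY n
    simp only [fccForm, h1, h2, h3]
    ring
  have m2 : ∑' n, fccY n ^ 2 * exp (-a * fccForm n) = fccMoment a := by
    rw [fccMoment, ← tsum_fcc_comp a (fun n => fccX n ^ 2) fccSwapXY eXY]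
    simp only [(fcc_swapXY _).1]
  have m3 : ∑' n, fccZ n ^ 2 * exp (-a * fccForm n) = fccMoment a := by
    rw [fccMoment, ← tsum_fcc_comp a (fun n => fccX n ^ 2) fccSwapXZ eXZ]
    simp only [(fcc_swapXZ _).1]
  have m4 : ∑' n, fccX n * fccY n * exp (-a * fccForm n) = 0 :=
    tsum_fcc_eq_zero a (fun n => fccX n * fccY n) fccReflY eY fun n => by
      simp only [(fcc_reflY n).1, (fcc_reflY n).2.1, mul_neg]
  have m5 : ∑' n, fccX n * fccZ n * exp (-a * fccForm n) = 0 :=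
    tsum_fcc_eq_zero a (fun n => fccX n * fccZ n) fccReflZ eZ fun n => by
      simp only [(fcc_reflZ n).1, (fcc_reflZ n).2.2, mul_neg]
  have m6 : ∑' n, fccY n * fccZ n * exp (-a * fccForm n) = 0 :=
    tsum_fcc_eq_zero a (fun n => fccY n * fccZ n) fccReflZ eZ fun n => by
      simp only [(fcc_reflZ n).2.1, (fcc_reflZ n).2.2, mul_neg]
  have hsq : ∀ x y z : ℝ, |x ^ 2| ≤ 2 * ((x ^ 2 + y ^ 2 + z ^ 2) / 2) := fun x y z => by
    rw [abs_of_nonneg (sq_nonneg x)]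
    nlinarith [sq_nonneg y, sq_nonneg z]
  have hxy : ∀ x y z : ℝ, |x * y| ≤ 2 * ((x ^ 2 + y ^ 2 + z ^ 2) / 2) := fun x y z => by
    rw [abs_le]
    constructor <;> nlinarith [sq_nonneg (x + y), sq_nonneg (x - y), sq_nonneg z,
      sq_nonneg x, sq_nonneg y]
  have s1 : Summable fun n => fccX n ^ 2 * exp (-a * fccForm n) :=
    summable_mul_exp_fccForm (c := 2) ha fun n => hsq _ _ _
  have s2 : Summable fun n => fccY n ^ 2 * exp (-a * fccForm n) :=
    summable_mul_exp_fccForm (c := 2) ha fun n => (hsq _ (fccX n) (fccZ n)).trans_eq (by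
      unfold fccForm; ring)
  have s3 : Summable fun n => fccZ n ^ 2 * exp (-a * fccForm n) :=
    summable_mul_exp_fccForm (c := 2) ha fun n => (hsq _ (fccX n) (fccY n)).trans_eq (by
      unfold fccForm; ring)
  have s4 : Summable fun n => fccX n * fccY n * exp (-a * fccForm n) :=
    summable_mul_exp_fccForm (c := 2) ha fun n => hxy _ _ _
  have s5 : Summable fun n => fccX n * fccZ n * exp (-a * fccForm n) :=
    summable_mul_exp_fccForm (c := 2) ha fun n => (hxy _ _ (fccY n)).trans_eq (by
      unfold fccForm; ring)
  have s6 : Summable fun n => fccY n * fccZ n * exp (-a * fccForm n) :=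
    summable_mul_exp_fccForm (c := 2) ha fun n => (hxy _ _ (fccX n)).trans_eq (by
      unfold fccForm; ring)
  have H := ((((s1.hasSum.mul_left (s 0)).add (s2.hasSum.mul_left (s 1))).add
    (s3.hasSum.mul_left (s 2))).add ((((s4.hasSum.mul_left (s 3)).add
    (s5.hasSum.mul_left (s 4))).add (s6.hasSum.mul_left (s 5))).mul_left 2)).tsum_eq
  rw [m2, m3, m4, m5, m6, ← fccMoment] at H
  rw [show (s 0 + s 1 + s 2) * fccMoment a = s 0 * fccMoment a + s 1 * fccMoment a +
    s 2 * fccMoment a + 2 * (s 3 * 0 + s 4 * 0 + s 5 * 0) by ring, ← H]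
  refine tsum_congr fun n => ?_
  unfold strainForm
  ring

/-! ### Second-order behaviour of the theta series at `D₃` -/

theorem abs_exp_sub_one_sub_id_le_sq_mul_exp (x : ℝ) :
    |exp x - 1 - x| ≤ x ^ 2 * exp |x| := by
  have h := Complex.norm_exp_sub_sum_le_norm_mul_exp (x : ℂ) 2
  have e : Complex.exp (x : ℂ) - ∑ m ∈ Finset.range 2, (x : ℂ) ^ m / (m.factorial : ℂ)
      = ((exp x - 1 - x : ℝ) : ℂ) := by
    simp [Finset.sum_range_succ]
    ring
  rwa [e, Complex.norm_real, Complex.norm_real, norm_eq_abs, norm_eq_abs, sq_abs] at h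

theorem add_sq_div_four_le_exp {x : ℝ} (hx : |x| ≤ 1) : 1 + x + x ^ 2 / 4 ≤ exp x := by
  have h := exp_bound hx (n := 3) (by norm_num)
  simp [Finset.sum_range_succ, Nat.factorial] at h
  have h1 := (abs_le.1 h).1
  have h2 : |x| ^ 3 ≤ x ^ 2 := by
    rw [← sq_abs x]
    exact pow_le_pow_of_le_one (abs_nonneg x) hx (by norm_num)
  nlinarith [sq_nonneg x]

theorem abs_trace_le {s : Fin 6 → ℝ} (hs : IsVolumePreserving s) (h1 : ‖s‖ ≤ 1) :
    |s 0 + s 1 + s 2| ≤ 36 * ‖s‖ ^ 2 := by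
  have hi : ∀ i, |s i| ≤ ‖s‖ := fun i => norm_le_pi_norm s i
  have h2 : ∀ i j, |s i * s j| ≤ ‖s‖ ^ 2 := fun i j => by
    rw [abs_mul, sq]
    exact mul_le_mul (hi i) (hi j) (abs_nonneg _) (norm_nonneg s)
  have h3 : ∀ i j k, |s i * s j * s k| ≤ ‖s‖ ^ 2 := fun i j k => by
    rw [abs_mul, ← mul_one (‖s‖ ^ 2)]
    exact mul_le_mul (h2 i j) ((hi k).trans h1) (abs_nonneg _) (by positivity)
  rw [hs]
  have a1 := h2 0 1
  have a2 := h2 0 2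
  have a3 := h2 1 2
  have a4 := h2 3 3
  have a5 := h2 4 4
  have a6 := h2 5 5
  have b1 := h3 0 1 2
  have b2 := h3 3 4 5
  have b3 := h3 0 5 5
  have b4 := h3 1 4 4
  have b5 := h3 2 3 3
  rw [abs_le] at *
  constructor <;> nlinarith

/-- The remainder of second order of `exp (-a (Q + h))` at `h = 0`, for the form `Q` of `D₃`. -/
noncomputable def expRemainder (a : ℝ) (s : Fin 6 → ℝ) (n : ℤ × ℤ × ℤ) : ℝ :=
  exp (-a * fccForm n) * (exp (-a * strainForm s n) - 1 + a * strainForm s n)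

theorem expRemainder_nonneg (a : ℝ) (s : Fin 6 → ℝ) (n : ℤ × ℤ × ℤ) : 0 ≤ expRemainder a s n :=
  mul_nonneg (exp_pos _).le (by linarith [add_one_le_exp (-a * strainForm s n)])

theorem expRemainder_le {a : ℝ} (ha : 0 < a) {s : Fin 6 → ℝ} (hs : ‖s‖ ≤ 1 / 12)
    (n : ℤ × ℤ × ℤ) :
    expRemainder a s n ≤ 36 * a ^ 2 * ‖s‖ ^ 2 * (fccForm n ^ 2 * exp (-(a / 2) * fccForm n)) := by
  have hh := abs_strainForm_le s n
  have h0 := fccForm_nonneg n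
  have e : |-a * strainForm s n| = a * |strainForm s n| := by
    rw [abs_mul, abs_neg, abs_of_pos ha]
  have h1 := (le_abs_self _).trans (abs_exp_sub_one_sub_id_le_sq_mul_exp (-a * strainForm s n))
  rw [e] at h1
  have h2 : (-a * strainForm s n) ^ 2 ≤ 36 * a ^ 2 * ‖s‖ ^ 2 * fccForm n ^ 2 := by
    rw [← sq_abs, e]
    calc (a * |strainForm s n|) ^ 2 ≤ (a * (6 * ‖s‖ * fccForm n)) ^ 2 := by gcongr
      _ = _ := by ring
  have h3 : a * |strainForm s n| ≤ a / 2 * fccForm n := by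
    have : 6 * ‖s‖ * fccForm n ≤ 1 / 2 * fccForm n := by
      apply mul_le_mul_of_nonneg_right _ h0
      linarith
    nlinarith
  calc expRemainder a s n
      ≤ exp (-a * fccForm n) * ((-a * strainForm s n) ^ 2 * exp (a * |strainForm s n|)) := by
        unfold expRemainder
        refine mul_le_mul_of_nonneg_left ?_ (exp_pos _).le
        linarith
    _ ≤ exp (-a * fccForm n) * (36 * a ^ 2 * ‖s‖ ^ 2 * fccForm n ^ 2 * exp (a / 2 * fccForm n)) := by
        gcongr
    _ = 36 * a ^ 2 * ‖s‖ ^ 2 * (fccForm n ^ 2 *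
          (exp (-a * fccForm n) * exp (a / 2 * fccForm n))) := by ring
    _ = _ := by
        rw [← exp_add]
        ring_nf

theorem summable_expRemainder {a : ℝ} (ha : 0 < a) {s : Fin 6 → ℝ} (hs : ‖s‖ ≤ 1 / 12) :
    Summable (expRemainder a s) :=
  Summable.of_nonneg_of_le (expRemainder_nonneg a s) (expRemainder_le ha hs)
    ((summable_fccForm_pow 2 (half_pos ha)).mul_left _)

theorem fccForm_add_strainForm_ge {s : Fin 6 → ℝ} (hs : ‖s‖ ≤ 1 / 12) (n : ℤ × ℤ × ℤ) :
    1 / 8 * intNormSq n ≤ fccForm n + strainForm s n := by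
  have h1 := (abs_le.1 (abs_strainForm_le s n)).1
  have h2 : 6 * ‖s‖ * fccForm n ≤ 1 / 2 * fccForm n :=
    mul_le_mul_of_nonneg_right (by linarith) (fccForm_nonneg n)
  have := fccForm_ge n
  linarith

theorem thetaSum_add_strainForm {a : ℝ} (ha : 0 < a) {s : Fin 6 → ℝ} (hs : ‖s‖ ≤ 1 / 12) :
    thetaSum a (fun n => fccForm n + strainForm s n) =
      thetaSum a fccForm + ∑' n, expRemainder a s n - a * (s 0 + s 1 + s 2) * fccMoment a := by
  have h1 := (summable_exp_fccForm ha).hasSum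
  have h2 := (summable_expRemainder ha hs).hasSum
  have h3 := (summable_mul_exp_fccForm ha (abs_strainForm_le s)).hasSum
  rw [tsum_strainForm ha] at h3
  rw [mul_assoc, thetaSum, thetaSum, ← ((h1.add h2).sub (h3.mul_left a)).tsum_eq]
  refine tsum_congr fun n => ?_
  rw [mul_add, exp_add, expRemainder]
  ring

/-- Along volume-preserving strains the theta series is stationary at `D₃`. -/
theorem exists_abs_thetaSum_sub_le {a : ℝ} (ha : 0 < a) :
    ∃ K, ∀ s, IsVolumePreserving s → ‖s‖ ≤ 1 / 12 →
      |thetaSum a (fun n => fccForm n + strainForm s n) - thetaSum a fccForm| ≤ K * ‖s‖ ^ 2 := by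
  refine ⟨36 * a ^ 2 * ∑' n, fccForm n ^ 2 * exp (-(a / 2) * fccForm n) + a * 36 * |fccMoment a|,
    fun s hv hs => ?_⟩
  have h1 : ∑' n, expRemainder a s n ≤
      36 * a ^ 2 * ‖s‖ ^ 2 * ∑' n, fccForm n ^ 2 * exp (-(a / 2) * fccForm n) := by
    rw [← tsum_mul_left]
    exact (summable_expRemainder ha hs).tsum_le_tsum (expRemainder_le ha hs)
      ((summable_fccForm_pow 2 (half_pos ha)).mul_left _)
  have h0 : 0 ≤ ∑' n, expRemainder a s n := tsum_nonneg (expRemainder_nonneg a s)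
  have h2 : |a * (s 0 + s 1 + s 2) * fccMoment a| ≤ a * (36 * ‖s‖ ^ 2) * |fccMoment a| := by
    rw [abs_mul, abs_mul, abs_of_pos ha]
    gcongr
    exact abs_trace_le hv (by linarith)
  rw [thetaSum_add_strainForm ha hs]
  rw [abs_le] at *
  constructor <;> linarith

theorem fccMoment_le {a : ℝ} (ha : 1 ≤ a) :
    fccMoment a ≤ 2 * exp (1 - a) * ∑' n, fccForm n * exp (-1 * fccForm n) := by
  have s1 : Summable fun n => fccForm n * exp (-1 * fccForm n) := by
    simpa only [pow_one] using summable_fccForm_pow 1 one_pos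
  rw [fccMoment, ← tsum_mul_left]
  refine Summable.tsum_le_tsum (fun n => ?_) ?_ (s1.mul_left _)
  · have h1 : fccX n ^ 2 ≤ 2 * fccForm n := by
      unfold fccForm
      nlinarith [sq_nonneg (fccY n), sq_nonneg (fccZ n)]
    rcases fccForm_eq_zero_or_one_le n with h | h
    · rw [h] at h1 ⊢
      simpa using h1
    · calc fccX n ^ 2 * exp (-a * fccForm n) ≤ 2 * fccForm n * exp (1 - a + -1 * fccForm n) := by
            gcongr
            nlinarith
        _ = _ := by rw [exp_add]; ring
  · refine summable_mul_exp_fccForm (c := 2) (by linarith) fun n => ?_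
    rw [abs_of_nonneg (sq_nonneg _)]
    unfold fccForm
    nlinarith [sq_nonneg (fccY n), sq_nonneg (fccZ n)]

/-- Half of the twelve minimal vectors of `D₃`, one from each antipodal pair. -/
def fccMinimal : Finset (ℤ × ℤ × ℤ) :=
  {(1, 0, 0), (0, 1, 0), (0, 0, 1), (1, 1, -1), (0, -1, 1), (1, 0, -1)}

theorem fccForm_of_mem_fccMinimal {n : ℤ × ℤ × ℤ} (hn : n ∈ fccMinimal) : fccForm n = 1 := by
  simp only [fccMinimal, Finset.mem_insert, Finset.mem_singleton] at hn
  rcases hn with rfl | rfl | rfl | rfl | rfl | rfl <;>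
    norm_num [fccForm, fccX, fccY, fccZ]

/-- `D₃` is perfect: a strain is controlled by its values on the minimal vectors. -/
theorem norm_sq_le_sum_fccMinimal (s : Fin 6 → ℝ) :
    ‖s‖ ^ 2 ≤ ∑ n ∈ fccMinimal, strainForm s n ^ 2 := by
  have e : ∑ n ∈ fccMinimal, strainForm s n ^ 2 =
      2 * ((s 0 + s 1) ^ 2 + (s 0 + s 2) ^ 2 + (s 1 + s 2) ^ 2)
        + 8 * (s 3 ^ 2 + s 4 ^ 2 + s 5 ^ 2) := by
    simp [fccMinimal, strainForm, fccX, fccY, fccZ]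
    ring
  rw [e]
  have hi : ∀ i, s i ^ 2 ≤ 2 * ((s 0 + s 1) ^ 2 + (s 0 + s 2) ^ 2 + (s 1 + s 2) ^ 2)
        + 8 * (s 3 ^ 2 + s 4 ^ 2 + s 5 ^ 2) := fun i => by
    fin_cases i <;> simp only [Fin.zero_eta, Fin.mk_one, Fin.reduceFinMk] <;>
    nlinarith [sq_nonneg (s 0), sq_nonneg (s 1), sq_nonneg (s 2), sq_nonneg (s 3), sq_nonneg (s 4),
      sq_nonneg (s 5), sq_nonneg (s 0 + s 1 + s 2)]
  refine (le_sqrt (norm_nonneg s) ?_).1 ?_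
  · exact (sq_nonneg _).trans (hi 0)
  · refine (pi_norm_le_iff_of_nonneg (sqrt_nonneg _)).2 fun i => ?_
    exact abs_le_sqrt (hi i)

/-- For a narrow Gaussian the convexity of the exponential on the minimal vectors outweighs the
second-order part of the trace of a volume-preserving strain. -/
theorem exists_thetaSum_le : ∃ a₁, 1 ≤ a₁ ∧ ∀ a, a₁ < a → ∃ ε, 0 < ε ∧ ε ≤ 1 / 12 ∧
    ∀ s, IsVolumePreserving s → ‖s‖ ≤ ε →
      thetaSum a fccForm ≤ thetaSum a (fun n => fccForm n + strainForm s n) := by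
  set K := ∑' n, fccForm n * exp (-1 * fccForm n) with hK
  refine ⟨max 1 (288 * exp 1 * K), le_max_left _ _, fun a ha => ?_⟩
  obtain ⟨h1, h2⟩ := max_lt_iff.1 ha
  have ha0 : 0 < a := by linarith
  refine ⟨min (1 / 12) (1 / (6 * a)), by positivity, min_le_left _ _, fun s hv hs => ?_⟩
  obtain ⟨hs1, hs2⟩ := le_min_iff.1 hs
  rw [thetaSum_add_strainForm ha0 hs1]
  have hmin : exp (-a) * (a ^ 2 / 4) * ‖s‖ ^ 2 ≤ ∑' n, expRemainder a s n := by
    calc exp (-a) * (a ^ 2 / 4) * ‖s‖ ^ 2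
        ≤ exp (-a) * (a ^ 2 / 4) * ∑ n ∈ fccMinimal, strainForm s n ^ 2 := by
          gcongr
          exact norm_sq_le_sum_fccMinimal s
      _ ≤ ∑ n ∈ fccMinimal, expRemainder a s n := by
          rw [Finset.mul_sum]
          refine Finset.sum_le_sum fun n hn => ?_
          have hQ := fccForm_of_mem_fccMinimal hn
          have hh := abs_strainForm_le s n
          rw [hQ, mul_one] at hh
          have hx : |-a * strainForm s n| ≤ 1 := by
            rw [abs_mul, abs_neg, abs_of_pos ha0]
            rw [le_div_iff₀ (by positivity)] at hs2
            nlinarith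
          have := add_sq_div_four_le_exp hx
          rw [expRemainder, hQ, mul_one, mul_assoc]
          refine mul_le_mul_of_nonneg_left ?_ (exp_pos _).le
          linarith
      _ ≤ _ := (summable_expRemainder ha0 hs1).sum_le_tsum _ fun n _ => expRemainder_nonneg a s n
  have hM0 : 0 ≤ fccMoment a :=
    tsum_nonneg fun n => mul_nonneg (sq_nonneg _) (exp_pos _).le
  have hM := fccMoment_le h1.le
  rw [← hK, sub_eq_add_neg, exp_add] at hM
  have ht : a * (s 0 + s 1 + s 2) * fccMoment a ≤
      a * (36 * ‖s‖ ^ 2) * (2 * (exp 1 * exp (-a)) * K) := by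
    calc _ ≤ a * (36 * ‖s‖ ^ 2) * fccMoment a := by
          gcongr
          exact (le_abs_self _).trans (abs_trace_le hv (by linarith))
      _ ≤ _ := by gcongr
  have hfin : a * (36 * ‖s‖ ^ 2) * (2 * (exp 1 * exp (-a)) * K) ≤
      exp (-a) * (a ^ 2 / 4) * ‖s‖ ^ 2 := by
    have : 0 ≤ exp (-a) * a * ‖s‖ ^ 2 / 4 := by positivity
    nlinarith [mul_le_mul_of_nonneg_left h2.le this]
  linarith

/-! ### The lattice parameters as strains of `D₃` -/

/-- The entries of `S`, in the order used by `strainForm`, for which the form of the lattice with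
parameters `q` is `fccForm + strainForm`. -/
noncomputable def fccStrain (q : Fin 5 → ℝ) : Fin 6 → ℝ :=
  ![((1 + q 2) ^ 2 + q 1 ^ 2) / 4 / q 0 - 1 / 2,
    ((1 - q 2) ^ 2 + q 1 ^ 2) / 4 / q 0 - 1 / 2,
    ((q 3 - (1 + q 2) / 2) ^ 2 + q 1 ^ 2 * (q 4 - 1 / 2) ^ 2) / q 0
      + q 0 ^ 2 / (2 * q 1 ^ 2) - 1 / 2,
    (1 - q 2 ^ 2 - q 1 ^ 2) / 4 / q 0,
    ((1 + q 2) / 2 * (q 3 - (1 + q 2) / 2) + q 1 ^ 2 * (q 4 - 1 / 2) / 2) / q 0,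
    ((1 - q 2) / 2 * (q 3 - (1 + q 2) / 2) - q 1 ^ 2 * (q 4 - 1 / 2) / 2) / q 0]

theorem bravaisForm_eq_add_strainForm {q : Fin 5 → ℝ} (hq : q ∈ bravaisDomain) :
    bravaisForm q = fun n => fccForm n + strainForm (fccStrain q) n := by
  have h0 := hq.1.ne'
  have h1 := hq.2.ne'
  funext n
  simp only [bravaisForm, fccForm, strainForm, fccStrain, fccX, fccY, fccZ, Matrix.cons_val_zero,
    Matrix.cons_val_one, Matrix.cons_val]
  field_simp
  ring

theorem isVolumePreserving_fccStrain {q : Fin 5 → ℝ} (hq : q ∈ bravaisDomain) :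
    IsVolumePreserving (fccStrain q) := by
  have h0 := hq.1.ne'
  have h1 := hq.2.ne'
  simp only [IsVolumePreserving, fccStrain, Matrix.cons_val_zero,
    Matrix.cons_val_one, Matrix.cons_val]
  field_simp
  ring

theorem fccParam_mem : fccParam ∈ bravaisDomain := by
  constructor <;> norm_num [fccParam]

theorem fccStrain_fccParam : fccStrain fccParam = 0 := by
  funext i
  fin_cases i <;> simp [fccStrain, fccParam] <;> norm_num

theorem differentiableAt_fccStrain {q : Fin 5 → ℝ} (hq : q ∈ bravaisDomain) :
    DifferentiableAt ℝ fccStrain q := by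
  have h0 := hq.1.ne'
  have h1 : 2 * q 1 ^ 2 ≠ 0 := by
    have := hq.2
    positivity
  rw [differentiableAt_pi]
  intro i
  fin_cases i <;> simp only [fccStrain, Fin.zero_eta, Fin.mk_one, Fin.reduceFinMk,
    Matrix.cons_val_zero, Matrix.cons_val_one, Matrix.cons_val] <;> fun_prop (disch := assumption)

theorem eventually_norm_fccStrain_le {ε : ℝ} (hε : 0 < ε) :
    ∀ᶠ q in 𝓝 fccParam, ‖fccStrain q‖ ≤ ε := by
  have h := (differentiableAt_fccStrain fccParam_mem).continuousAt.norm.tendsto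
  rw [fccStrain_fccParam, norm_zero] at h
  exact (h.eventually (gt_mem_nhds hε)).mono fun _ => le_of_lt

theorem eventually_mem_bravaisDomain {q : Fin 5 → ℝ} (hq : q ∈ bravaisDomain) :
    ∀ᶠ p in 𝓝 q, p ∈ bravaisDomain := by
  have h0 := (continuous_apply (A := fun _ : Fin 5 => ℝ) 0).continuousAt.tendsto.eventually
    (lt_mem_nhds hq.1)
  have h1 := (continuous_apply (A := fun _ : Fin 5 => ℝ) 1).continuousAt.tendsto.eventually
    (lt_mem_nhds hq.2)
  exact h0.and h1

theorem bravaisForm_fccParam : bravaisForm fccParam = fccForm := by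
  rw [bravaisForm_eq_add_strainForm fccParam_mem, fccStrain_fccParam]
  funext n
  simp [strainForm]

theorem bravaisEnergy_eq_of_norm_le {q : Fin 5 → ℝ} (hq : q ∈ bravaisDomain)
    (hs : ‖fccStrain q‖ ≤ 1 / 12) {α : ℝ} (hα : 0 < α) :
    bravaisEnergy (gaussPotential α) 1 q =
      thetaSum (α * scaleConst 1) (bravaisForm q) - 1 := by
  refine bravaisEnergy_eq hq (summable_exp_neg (c := 1 / 8) (by norm_num) (fun n => ?_)
    (mul_pos hα scaleConst_one_pos))
  rw [bravaisForm_eq_add_strainForm hq]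
  exact fccForm_add_strainForm_ge hs n

theorem bravaisEnergy_fccParam {α : ℝ} (hα : 0 < α) :
    bravaisEnergy (gaussPotential α) 1 fccParam = thetaSum (α * scaleConst 1) fccForm - 1 := by
  rw [bravaisEnergy_eq_of_norm_le fccParam_mem (by simp [fccStrain_fccParam]) hα,
    bravaisForm_fccParam]

theorem isCriticalLattice_fccParam {α : ℝ} (hα : 0 < α) :
    IsCriticalLattice (gaussPotential α) 1 fccParam := by
  refine ⟨fccParam_mem, ?_⟩
  obtain ⟨K, hK⟩ := exists_abs_thetaSum_sub_le (mul_pos hα scaleConst_one_pos)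
  have h1 : (fun q => bravaisEnergy (gaussPotential α) 1 q
      - bravaisEnergy (gaussPotential α) 1 fccParam) =O[𝓝 fccParam]
      fun q => ‖fccStrain q‖ ^ 2 := by
    refine Asymptotics.IsBigO.of_bound K ?_
    filter_upwards [eventually_mem_bravaisDomain fccParam_mem,
      eventually_norm_fccStrain_le (ε := 1 / 12) (by norm_num)] with q hq hs
    rw [bravaisEnergy_eq_of_norm_le hq hs hα, bravaisEnergy_fccParam hα, sub_sub_sub_cancel_right,
      bravaisForm_eq_add_strainForm hq, norm_pow, norm_norm]
    exact hK _ (isVolumePreserving_fccStrain hq) hs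
  have h2 : (fun q => ‖fccStrain q‖ ^ 2) =O[𝓝 fccParam] fun q => ‖q - fccParam‖ ^ 2 := by
    have h := (differentiableAt_fccStrain fccParam_mem).isBigO_sub
    simp only [fccStrain_fccParam, sub_zero] at h
    exact h.norm_norm.pow 2
  have h3 := (h1.trans h2).hasFDerivAt (𝕜 := ℝ) one_lt_two
  simpa using h3.add_const (bravaisEnergy (gaussPotential α) 1 fccParam)

theorem exists_isLocalMinLattice_fccParam :
    ∃ α₁ : ℝ, 0 < α₁ ∧ ∀ α, α₁ < α → IsLocalMinLattice (gaussPotential α) 1 fccParam := by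
  obtain ⟨a₁, ha₁, h⟩ := exists_thetaSum_le
  have hC := scaleConst_one_pos
  refine ⟨a₁ / scaleConst 1, by positivity, fun α hα => ⟨fccParam_mem, ?_⟩⟩
  have hα0 : 0 < α := lt_trans (by positivity) hα
  obtain ⟨ε, hε, hε', hmin⟩ := h (α * scaleConst 1) ((div_lt_iff₀ hC).1 hα)
  filter_upwards [nhdsWithin_le_nhds (eventually_norm_fccStrain_le hε), self_mem_nhdsWithin]
    with q hs hq
  rw [bravaisEnergy_eq_of_norm_le hq (hs.trans hε') hα0, bravaisEnergy_fccParam hα0,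
    bravaisForm_eq_add_strainForm hq]
  linarith [hmin _ (isVolumePreserving_fccStrain hq) hs]

/-! ### Poisson summation for centred orthorhombic lattices -/

/-- Jacobi's transformation formula for a Gaussian twisted by the character `n ↦ (-1) ^ (k n)`. -/
theorem tsum_neg_one_zpow_mul_exp {c : ℝ} (hc : 0 < c) (k : ℤ) :
    ∑' n : ℤ, (-1 : ℝ) ^ (k * n) * exp (-c * (n : ℝ) ^ 2) =
      √(π / c) * ∑' m : ℤ, exp (-(π ^ 2 / c) * (m + k / 2 : ℝ) ^ 2) := by
  have hπ : (π : ℂ) ≠ 0 := by exact_mod_cast pi_pos.ne'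
  have ha : 0 < ((c / π : ℝ) : ℂ).re := by
    rw [Complex.ofReal_re]
    positivity
  have h := Complex.tsum_exp_neg_quadratic ha (-Complex.I * k / 2)
  have e1 : ∀ n : ℤ, Complex.exp (-π * ((c / π : ℝ) : ℂ) * n ^ 2
      + 2 * π * (-Complex.I * k / 2) * n)
      = (((-1 : ℝ) ^ (k * n) * exp (-c * (n : ℝ) ^ 2) : ℝ) : ℂ) := fun n => by
    rw [Complex.exp_add, mul_comm]
    push_cast
    congr 1
    · rw [show 2 * (π : ℂ) * (-Complex.I * k / 2) * n = ((-(k * n) : ℤ) : ℂ) * (π * Complex.I) by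
        push_cast; ring, Complex.exp_int_mul, Complex.exp_pi_mul_I, zpow_neg, ← inv_zpow, inv_neg,
        inv_one]
    · congr 1
      field_simp
  have e2 : ∀ n : ℤ, Complex.exp (-π / ((c / π : ℝ) : ℂ) *
      (n + Complex.I * (-Complex.I * k / 2)) ^ 2)
      = ((exp (-(π ^ 2 / c) * (n + k / 2 : ℝ) ^ 2) : ℝ) : ℂ) := fun n => by
    have hI : Complex.I * (-Complex.I * k / 2) = k / 2 := by
      linear_combination (-(k : ℂ) / 2) * Complex.I_mul_I
    rw [hI]
    push_cast
    congr 1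
    have : (c : ℂ) ≠ 0 := by exact_mod_cast hc.ne'
    field_simp
  have e3 : 1 / ((c / π : ℝ) : ℂ) ^ (1 / 2 : ℂ) = ((√(π / c) : ℝ) : ℂ) := by
    rw [show (1 / 2 : ℂ) = ((1 / 2 : ℝ) : ℂ) by push_cast; rfl,
      ← Complex.ofReal_cpow (by positivity), ← sqrt_eq_rpow, ← inv_div c π, sqrt_inv]
    push_cast
    rw [one_div]
  simp only [e1, e2, e3] at h
  exact_mod_cast h

/-- The formula `tsum_neg_one_zpow_mul_exp` read from right to left. -/
theorem tsum_exp_neg_mul_add_half_sq {c : ℝ} (hc : 0 < c) (k : ℤ) :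
    ∑' m : ℤ, exp (-c * (m + k / 2 : ℝ) ^ 2) =
      √(π / c) * ∑' n : ℤ, (-1 : ℝ) ^ (k * n) * exp (-(π ^ 2 / c) * (n : ℝ) ^ 2) := by
  have h := tsum_neg_one_zpow_mul_exp (c := π ^ 2 / c) (by positivity) k
  rw [show π ^ 2 / (π ^ 2 / c) = c by field_simp,
    show π / (π ^ 2 / c) = (π / c)⁻¹ by field_simp, sqrt_inv] at h
  have : √(π / c) ≠ 0 := (sqrt_pos.2 (by positivity)).ne'
  rw [h, mul_inv_cancel_left₀ this]

theorem tsum_int_triple {F : ℤ × ℤ × ℤ → ℝ} (hF : Summable F) :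
    ∑' n, F n = ∑' i, ∑' j, ∑' l, F (i, j, l) := by
  rw [hF.tsum_prod]
  exact tsum_congr fun i => (hF.prod_factor i).tsum_prod

/-- The cyclic permutation `(l, i, j) ↦ (i, j, l)` of coordinates. -/
def cycleCoords : ℤ × ℤ × ℤ ≃ ℤ × ℤ × ℤ where
  toFun n := (n.2.1, n.2.2, n.1)
  invFun n := (n.2.2, n.1, n.2.1)
  left_inv _ := rfl
  right_inv _ := rfl

theorem tsum_int_triple' {F : ℤ × ℤ × ℤ → ℝ} (hF : Summable F) :
    ∑' n, F n = ∑' l, ∑' i, ∑' j, F (i, j, l) := by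
  rw [← cycleCoords.tsum_eq F]
  exact tsum_int_triple (cycleCoords.summable_iff.2 hF)

/-- The form, on the lattice dual to that of parameters `(u, v, 0, 1/2, 1/2)`, which appears on
the other side of Poisson summation. The dual lattice consists of the integer points
`(k₁, k₂, 2 k₃ + k₁ + k₂)`, those with even coordinate sum. -/
noncomputable def dualForm (u v : ℝ) (k : ℤ × ℤ × ℤ) : ℝ :=
  u * (k.1 : ℝ) ^ 2 + u / v ^ 2 * (k.2.1 : ℝ) ^ 2
    + v ^ 2 / (2 * u ^ 2) * (2 * k.2.2 + k.1 + k.2.1 : ℝ) ^ 2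

theorem thetaSum_eq_mul_thetaSum_dualForm {a u v : ℝ} (ha : 0 < a) (hu : 0 < u) (hv : 0 < v)
    (hs : Summable fun n => exp (-a * bravaisForm ![u, v, 0, 1 / 2, 1 / 2] n))
    (hd : Summable fun k => exp (-(π ^ 2 / a) * dualForm u v k)) :
    thetaSum a (bravaisForm ![u, v, 0, 1 / 2, 1 / 2]) =
      √(2 * (π / a) ^ 3) * thetaSum (π ^ 2 / a) (dualForm u v) := by
  set A := a / u with hA
  set B := a * v ^ 2 / u with hB
  set D := a * u ^ 2 / (2 * v ^ 2) with hD
  have hA0 : 0 < A := by positivity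
  have hB0 : 0 < B := by positivity
  have hD0 : 0 < D := by positivity
  let f : ℤ → ℝ := fun n => exp (-(π ^ 2 / A) * (n : ℝ) ^ 2)
  let g : ℤ → ℝ := fun n => exp (-(π ^ 2 / B) * (n : ℝ) ^ 2)
  let h : ℤ → ℝ := fun n => exp (-D * (n : ℝ) ^ 2)
  have hG : Summable fun n : ℤ × ℤ × ℤ =>
      f n.1 * (g n.2.1 * ((-1 : ℝ) ^ ((n.1 + n.2.1) * n.2.2) * h n.2.2)) := by
    have sf : Summable f := summable_exp_neg_mul_int_sq (by positivity)
    have sg : Summable g := summable_exp_neg_mul_int_sq (by positivity)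
    have sh : Summable h := summable_exp_neg_mul_int_sq hD0
    have s2 := sg.mul_of_nonneg sh (fun _ => (exp_pos _).le) (fun _ => (exp_pos _).le)
    have s3 := sf.mul_of_nonneg s2 (fun _ => (exp_pos _).le)
      (fun _ => mul_nonneg (exp_pos _).le (exp_pos _).le)
    refine Summable.of_norm_bounded s3 fun n => le_of_eq ?_
    simp only [norm_mul, norm_zpow, norm_neg, norm_one, one_zpow, one_mul, norm_eq_abs, f, g, h,
      abs_exp]
  have step1 : thetaSum a (bravaisForm ![u, v, 0, 1 / 2, 1 / 2]) =
      ∑' l : ℤ, h l * ((∑' i : ℤ, exp (-A * (i + l / 2 : ℝ) ^ 2)) *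
        ∑' j : ℤ, exp (-B * (j + l / 2 : ℝ) ^ 2)) := by
    rw [thetaSum, tsum_int_triple' hs]
    refine tsum_congr fun l => ?_
    rw [← tsum_mul_right, ← tsum_mul_left]
    refine tsum_congr fun i => ?_
    rw [← tsum_mul_left, ← tsum_mul_left]
    refine tsum_congr fun j => ?_
    simp only [h]
    rw [← exp_add, ← exp_add]
    congr 1
    simp only [bravaisForm, hA, hB, hD, Matrix.cons_val_zero, Matrix.cons_val_one, Matrix.cons_val]
    field_simp
    ring
  have step2 : ∑' l : ℤ, h l * ((∑' i : ℤ, exp (-A * (i + l / 2 : ℝ) ^ 2)) *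
        ∑' j : ℤ, exp (-B * (j + l / 2 : ℝ) ^ 2)) =
      √(π / A) * √(π / B) * ∑' l, ∑' i, ∑' j,
        f i * (g j * ((-1 : ℝ) ^ ((i + j) * l) * h l)) := by
    rw [← tsum_mul_left]
    refine tsum_congr fun l => ?_
    rw [tsum_exp_neg_mul_add_half_sq hA0, tsum_exp_neg_mul_add_half_sq hB0]
    calc _ = √(π / A) * √(π / B) * (h l * ((∑' n : ℤ, (-1 : ℝ) ^ (l * n) * f n) *
            ∑' n : ℤ, (-1 : ℝ) ^ (l * n) * g n)) := by simp only [f, g]; ring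
      _ = _ := by
        rw [← tsum_mul_right, ← tsum_mul_left]
        congr 1
        refine tsum_congr fun i => ?_
        rw [← tsum_mul_left, ← tsum_mul_left]
        refine tsum_congr fun j => ?_
        rw [add_mul, zpow_add₀ (by norm_num), mul_comm i l, mul_comm j l]
        ring
  have step3 : ∑' k : ℤ × ℤ × ℤ, f k.1 * (g k.2.1 * ((-1 : ℝ) ^ ((k.1 + k.2.1) * k.2.2) * h k.2.2))
      = √(π / D) * thetaSum (π ^ 2 / a) (dualForm u v) := by
    rw [tsum_int_triple hG, thetaSum, tsum_int_triple hd, ← tsum_mul_left]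
    refine tsum_congr fun i => ?_
    rw [← tsum_mul_left]
    refine tsum_congr fun j => ?_
    have hh : ∑' l : ℤ, (-1 : ℝ) ^ ((i + j) * l) * h l = _ := tsum_neg_one_zpow_mul_exp hD0 (i + j)
    dsimp only
    rw [tsum_mul_left, tsum_mul_left, hh, mul_left_comm (g j),
      mul_left_comm (f i), ← tsum_mul_left, ← tsum_mul_left]
    congr 1
    refine tsum_congr fun m => ?_
    simp only [f, g]
    rw [← exp_add, ← exp_add]
    congr 1
    simp only [dualForm, hA, hB, hD]
    push_cast
    field_simp
    ring
  rw [step1, step2, ← tsum_int_triple' hG, step3, ← mul_assoc, ← sqrt_mul (by positivity),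
    ← sqrt_mul (by positivity)]
  congr 2
  simp only [hA, hB, hD]
  field_simp

/-! ### The body-centred-cubic form -/

/-- The quadratic form of the body-centred-cubic lattice dual to `D₃`. -/
noncomputable def bccForm (k : ℤ × ℤ × ℤ) : ℝ :=
  (k.1 : ℝ) ^ 2 + (k.2.1 : ℝ) ^ 2 + (2 * k.2.2 + k.1 + k.2.1 : ℝ) ^ 2 / 2

theorem dualForm_one_one : dualForm 1 1 = bccForm := by
  funext k
  simp only [dualForm, bccForm]
  ring

theorem bccForm_ge (k : ℤ × ℤ × ℤ) : 1 / 4 * intNormSq k ≤ bccForm k := by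
  unfold bccForm intNormSq
  nlinarith [sq_nonneg ((2 * k.2.2 + k.1 + k.2.1 : ℝ) + k.1 + k.2.1),
    sq_nonneg ((2 * k.2.2 + k.1 + k.2.1 : ℝ) + k.1), sq_nonneg ((2 * k.2.2 + k.1 + k.2.1 : ℝ) + k.2.1),
    sq_nonneg ((k.1 : ℝ) - k.2.1), sq_nonneg (2 * k.2.2 + k.1 + k.2.1 : ℝ)]

theorem bccForm_nonneg (k : ℤ × ℤ × ℤ) : 0 ≤ bccForm k := by
  unfold bccForm
  positivity

/-- The body-centred-cubic form has minimum `3/2` and its next value is `2`. -/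
theorem bccForm_cases (k : ℤ × ℤ × ℤ) :
    bccForm k = 0 ∨ ((k.1 : ℝ) ^ 2 + (k.2.1 : ℝ) ^ 2 = 1 ∧ (2 * k.2.2 + k.1 + k.2.1 : ℝ) ^ 2 = 1) ∨
      2 ≤ bccForm k := by
  obtain ⟨a, b, c⟩ := k
  have key : (2 * a ^ 2 + 2 * b ^ 2 + (2 * c + a + b) ^ 2 = 0) ∨
      (a ^ 2 + b ^ 2 = 1 ∧ (2 * c + a + b) ^ 2 = 1) ∨
      4 ≤ 2 * a ^ 2 + 2 * b ^ 2 + (2 * c + a + b) ^ 2 := by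
    by_contra! hcon
    obtain ⟨h1, h2, h3⟩ := hcon
    obtain ⟨d, hd⟩ : ∃ d, d = 2 * c + a + b := ⟨_, rfl⟩
    rw [← hd] at h1 h2 h3
    have ha : -1 ≤ a ∧ a ≤ 1 := by constructor <;> nlinarith [sq_nonneg b, sq_nonneg d]
    have hb : -1 ≤ b ∧ b ≤ 1 := by constructor <;> nlinarith [sq_nonneg a, sq_nonneg d]
    have hd' : -1 ≤ d ∧ d ≤ 1 := by constructor <;> nlinarith [sq_nonneg a, sq_nonneg b]
    obtain ⟨ha1, ha2⟩ := ha
    obtain ⟨hb1, hb2⟩ := hb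
    obtain ⟨hd1, hd2⟩ := hd'
    interval_cases a <;> interval_cases b <;> interval_cases d <;> simp at h1 h2 h3 <;> omega
  simp only [bccForm]
  rcases key with h | ⟨h, h'⟩ | h
  · left
    have : (2 * (a : ℝ) ^ 2 + 2 * (b : ℝ) ^ 2 + (2 * c + a + b : ℝ) ^ 2 = 0) := by exact_mod_cast h
    linarith
  · right; left
    exact ⟨by exact_mod_cast h, by exact_mod_cast h'⟩
  · right; right
    have : (4 : ℝ) ≤ 2 * (a : ℝ) ^ 2 + 2 * (b : ℝ) ^ 2 + (2 * c + a + b : ℝ) ^ 2 := by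
      exact_mod_cast h
    linarith

theorem half_bccForm_le_dualForm {u v : ℝ} (h1 : 1 / 2 ≤ u) (h2 : 1 / 2 ≤ u / v ^ 2)
    (h3 : 1 / 4 ≤ v ^ 2 / (2 * u ^ 2)) (k : ℤ × ℤ × ℤ) : 1 / 2 * bccForm k ≤ dualForm u v k := by
  have g1 := mul_le_mul_of_nonneg_right h1 (sq_nonneg (k.1 : ℝ))
  have g2 := mul_le_mul_of_nonneg_right h2 (sq_nonneg (k.2.1 : ℝ))
  have g3 := mul_le_mul_of_nonneg_right h3 (sq_nonneg (2 * k.2.2 + k.1 + k.2.1 : ℝ))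
  unfold bccForm dualForm
  linarith

theorem dualForm_ge {u v : ℝ} (h1 : 1 / 2 ≤ u) (h2 : 1 / 2 ≤ u / v ^ 2)
    (h3 : 1 / 4 ≤ v ^ 2 / (2 * u ^ 2)) (k : ℤ × ℤ × ℤ) :
    1 / 8 * intNormSq k ≤ dualForm u v k := by
  linarith [half_bccForm_le_dualForm h1 h2 h3 k, bccForm_ge k]

/-! ### Unstable and stable directions at the body-centred-cubic form -/

theorem summable_exp_dualForm {b u v : ℝ} (hb : 0 < b) (h1 : 1 / 2 ≤ u) (h2 : 1 / 2 ≤ u / v ^ 2)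
    (h3 : 1 / 4 ≤ v ^ 2 / (2 * u ^ 2)) : Summable fun k => exp (-b * dualForm u v k) :=
  summable_exp_neg (by norm_num) (dualForm_ge h1 h2 h3) hb

/-- `exp (-b (W + x)) + exp (-b (W + y)) - 2 exp (-b W)` with `W` factored out. -/
theorem exp_add_exp_sub (b W x y : ℝ) :
    exp (-b * (W + x)) + exp (-b * (W + y)) - 2 * exp (-b * W)
      = exp (-b * W) * (exp (-b * x) + exp (-b * y) - 2) := by
  rw [mul_add, mul_add, exp_add, exp_add]
  ring

theorem exp_neg_le_one_sub_half {x : ℝ} (h0 : 0 ≤ x) (h1 : x ≤ 1) : exp (-x) ≤ 1 - x / 2 := by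
  have h2 := add_one_le_exp x
  have h3 : exp (-x) * exp x = 1 := by rw [← exp_add]; simp
  have h4 : exp (-x) * (x + 1) ≤ 1 :=
    (mul_le_mul_of_nonneg_left h2 (exp_pos _).le).trans_eq h3
  by_contra! hcon
  nlinarith

/-- The tetragonal perturbation of the body-centred-cubic form in the direction of the Bain path. -/
theorem dualForm_bain (u : ℝ) (k : ℤ × ℤ × ℤ) :
    dualForm u 1 k = bccForm k + ((u - 1) * ((k.1 : ℝ) ^ 2 + (k.2.1 : ℝ) ^ 2)
      + (1 / u ^ 2 - 1) * ((2 * k.2.2 + k.1 + k.2.1 : ℝ) ^ 2 / 2)) := by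
  simp only [dualForm, bccForm]
  ring

theorem abs_one_div_sq_sub_one_le {u : ℝ} (h : |u - 1| ≤ 1 / 4) :
    |1 / u ^ 2 - 1| ≤ 4 * |u - 1| := by
  obtain ⟨h1, h2⟩ := abs_le.1 h
  have hu : 0 < u := by linarith
  have e : 1 / u ^ 2 - 1 = -((u - 1) * ((u + 1) / u ^ 2)) := by
    field_simp
    ring
  rw [e, abs_neg, abs_mul, mul_comm, abs_of_pos (show 0 < (u + 1) / u ^ 2 by positivity)]
  refine mul_le_mul_of_nonneg_right ?_ (abs_nonneg _)
  rw [div_le_iff₀ (by positivity)]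
  nlinarith

theorem sq_le_bain {u : ℝ} (h : |u - 1| ≤ 1 / 4) :
    (u - 1) ^ 2 ≤ (u - 1) + (1 / u ^ 2 - 1) * (1 / 2) := by
  obtain ⟨h1, h2⟩ := abs_le.1 h
  have hu : 0 < u := by linarith
  have e : (u - 1) + (1 / u ^ 2 - 1) * (1 / 2) = (u - 1) ^ 2 * ((2 * u + 1) / (2 * u ^ 2)) := by
    field_simp
    ring
  rw [e]
  refine le_mul_of_one_le_right (sq_nonneg _) ?_
  rw [le_div_iff₀ (by positivity)]
  nlinarith

theorem abs_mul_add_mul_le {x y c A B : ℝ} (hx : |x| ≤ c) (hy : |y| ≤ c) (hA : 0 ≤ A)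
    (hB : 0 ≤ B) : |x * A + y * B| ≤ c * (A + B) := by
  refine (abs_add_le _ _).trans ?_
  rw [abs_mul, abs_mul, abs_of_nonneg hA, abs_of_nonneg hB, mul_add]
  gcongr

/-- The change of the terms of the theta series, symmetrised in the sign of `t`. The terms of the
eight minimal vectors decrease, and the other ones are negligible for large `b`. -/
theorem bain_term_le {b t : ℝ} (hb : 1 ≤ b) (ht : 0 < t) (ht' : t ≤ 1 / 32) (hbt : b * t ^ 2 ≤ 1)
    (k : ℤ × ℤ × ℤ) :
    exp (-b * dualForm (1 + t) 1 k) + exp (-b * dualForm (1 - t) 1 k) - 2 * exp (-b * bccForm k) ≤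
      32 * b ^ 2 * t ^ 2 * exp (-(13 / 8) * b) * (bccForm k ^ 2 * exp (-(1 / 16) * bccForm k))
        + if k = (1, 0, 0) then -(b * t ^ 2 * exp (-(3 / 2) * b)) else 0 := by
  have hb0 : 0 < b := by linarith
  rw [dualForm_bain, dualForm_bain, exp_add_exp_sub]
  set W := bccForm k with hW
  have hW0 : 0 ≤ W := bccForm_nonneg k
  have hR : 0 ≤ 32 * b ^ 2 * t ^ 2 * exp (-(13 / 8) * b) * (W ^ 2 * exp (-(1 / 16) * W)) := by
    positivity
  have hWAB : W = ((k.1 : ℝ) ^ 2 + (k.2.1 : ℝ) ^ 2)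
      + (2 * k.2.2 + k.1 + k.2.1 : ℝ) ^ 2 / 2 := rfl
  have hA : 0 ≤ (k.1 : ℝ) ^ 2 + (k.2.1 : ℝ) ^ 2 := by positivity
  have hB : 0 ≤ (2 * k.2.2 + k.1 + k.2.1 : ℝ) ^ 2 / 2 := by positivity
  have hcase := bccForm_cases k
  rw [← hW] at hcase
  have hp : |(1 + t) - 1| = t := by rw [add_sub_cancel_left, abs_of_pos ht]
  have hm : |(1 - t) - 1| = t := by rw [sub_sub_cancel_left, abs_neg, abs_of_pos ht]
  have p1 := sq_le_bain (u := 1 + t) (by rw [hp]; linarith)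
  have m1 := sq_le_bain (u := 1 - t) (by rw [hm]; linarith)
  have p2 := abs_one_div_sq_sub_one_le (u := 1 + t) (by rw [hp]; linarith)
  have m2 := abs_one_div_sq_sub_one_le (u := 1 - t) (by rw [hm]; linarith)
  rw [hp] at p2
  rw [hm] at m2
  rw [add_sub_cancel_left] at p1 ⊢
  rw [sub_sub_cancel_left] at m1 ⊢
  -- The two coefficients of the third coordinate have nonnegative sum, by convexity of `1 / u ^ 2`.
  have hconv : 0 ≤ (1 / (1 + t) ^ 2 - 1) + (1 / (1 - t) ^ 2 - 1) := by
    have e1 : 1 - 2 * t ≤ 1 / (1 + t) ^ 2 := by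
      rw [le_div_iff₀ (by positivity)]
      nlinarith [pow_pos ht 3]
    have e2 : 1 + 2 * t ≤ 1 / (1 - t) ^ 2 := by
      have : 0 < 1 - t := by linarith
      rw [le_div_iff₀ (by positivity)]
      nlinarith [pow_pos ht 3]
    linarith
  generalize (k.1 : ℝ) ^ 2 + (k.2.1 : ℝ) ^ 2 = A at *
  generalize (1 / (1 + t) ^ 2 - 1) = c at *
  generalize (1 / (1 - t) ^ 2 - 1) = d at *
  rcases hcase with h0 | ⟨h1, h2⟩ | h2
  · have hA0 : A = 0 := by linarith
    have hB0 : (2 * k.2.2 + k.1 + k.2.1 : ℝ) ^ 2 / 2 = 0 := by linarith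
    have hk : k ≠ (1, 0, 0) := by
      rintro rfl
      norm_num at hB0
    rw [if_neg hk, hA0, hB0, h0]
    norm_num
  · have hW32 : W = 3 / 2 := by rw [hWAB, h1, h2]; norm_num
    rw [h1, h2, mul_one, mul_one]
    have hx : exp (-b * (t + c * (1 / 2))) ≤ 1 - b * t ^ 2 / 2 := by
      refine le_trans (exp_le_exp.2 ?_) (exp_neg_le_one_sub_half (x := b * t ^ 2) (by positivity) hbt)
      nlinarith
    have hy : exp (-b * (-t + d * (1 / 2))) ≤ 1 - b * t ^ 2 / 2 := by
      refine le_trans (exp_le_exp.2 ?_) (exp_neg_le_one_sub_half (x := b * t ^ 2) (by positivity) hbt)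
      nlinarith
    have hexp : exp (-b * W) = exp (-(3 / 2) * b) := by
      rw [hW32]
      congr 1
      ring
    have hE : exp (-b * W) * (exp (-b * (t + c * (1 / 2))) + exp (-b * (-t + d * (1 / 2))) - 2) ≤
        -(b * t ^ 2 * exp (-(3 / 2) * b)) := by
      calc _ ≤ exp (-b * W) * (-(b * t ^ 2)) :=
            mul_le_mul_of_nonneg_left (by linarith) (exp_pos _).le
        _ = _ := by rw [hexp]; ring
    have hneg : -(b * t ^ 2 * exp (-(3 / 2) * b)) ≤
        if k = (1, 0, 0) then -(b * t ^ 2 * exp (-(3 / 2) * b)) else 0 := by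
      split_ifs
      · exact le_rfl
      · have : 0 ≤ b * t ^ 2 * exp (-(3 / 2) * b) := by positivity
        linarith
    linarith
  · have hk : k ≠ (1, 0, 0) := by
      rintro rfl
      norm_num [hW, bccForm] at h2
    rw [if_neg hk, add_zero]
    generalize (2 * k.2.2 + k.1 + k.2.1 : ℝ) ^ 2 / 2 = B at *
    have hx : |t * A + c * B| ≤ 4 * t * W := by
      rw [hWAB]
      exact abs_mul_add_mul_le (by rw [abs_of_pos ht]; linarith) p2 hA hB
    have hy : |-t * A + d * B| ≤ 4 * t * W := by
      rw [hWAB]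
      exact abs_mul_add_mul_le (by rw [abs_neg, abs_of_pos ht]; linarith) m2 hA hB
    have hsum : 0 ≤ (t * A + c * B) + (-t * A + d * B) := by
      have := mul_nonneg hconv hB
      linarith
    have bound : ∀ x : ℝ, |x| ≤ 4 * t * W →
        exp (-b * x) ≤ 1 - b * x + 16 * b ^ 2 * t ^ 2 * W ^ 2 * exp (b / 8 * W) := fun x hx => by
      have h := (le_abs_self _).trans (abs_exp_sub_one_sub_id_le_sq_mul_exp (-b * x))
      have e : |-b * x| = b * |x| := by rw [abs_mul, abs_neg, abs_of_pos hb0]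
      rw [e, ← sq_abs, e] at h
      have h4 : b * |x| ≤ b / 8 * W := by
        have : 4 * t * W ≤ 1 / 8 * W := mul_le_mul_of_nonneg_right (by linarith) hW0
        nlinarith
      have h5 : (b * |x|) ^ 2 * exp (b * |x|) ≤ (b * (4 * t * W)) ^ 2 * exp (b / 8 * W) := by
        gcongr
      calc exp (-b * x) ≤ 1 - b * x + (b * (4 * t * W)) ^ 2 * exp (b / 8 * W) := by linarith
        _ = _ := by ring
    have b1 := bound _ hx
    have b2 := bound _ hy
    calc exp (-b * W) * (exp (-b * (t * A + c * B)) + exp (-b * (-t * A + d * B)) - 2)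
        ≤ exp (-b * W) * (32 * b ^ 2 * t ^ 2 * W ^ 2 * exp (b / 8 * W)) := by
          refine mul_le_mul_of_nonneg_left ?_ (exp_pos _).le
          have := mul_nonneg hb0.le hsum
          linarith
      _ = 32 * b ^ 2 * t ^ 2 * W ^ 2 * exp (-(7 / 8) * b * W) := by
          rw [mul_left_comm, ← exp_add]
          ring_nf
      -- `W ≥ 2` leaves `exp (-(13 / 8) b)`, which beats the `exp (-(3 / 2) b)` of minimal vectors.
      _ ≤ 32 * b ^ 2 * t ^ 2 * W ^ 2 * exp (-(13 / 8) * b + -(1 / 16) * W) := by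
          gcongr
          nlinarith
      _ = _ := by
          rw [exp_add]
          ring

/-- The theta series of a narrow Gaussian has no local minimum at the body-centred-cubic form. -/
theorem exists_thetaSum_bain_lt : ∃ b₀, 0 < b₀ ∧ ∀ b, b₀ < b → ∀ t, 0 < t → t ≤ 1 / 32 →
    b * t ^ 2 ≤ 1 → thetaSum b (dualForm (1 + t) 1) + thetaSum b (dualForm (1 - t) 1) <
      2 * thetaSum b bccForm := by
  set K := ∑' k, bccForm k ^ 2 * exp (-(1 / 16) * bccForm k) with hK
  refine ⟨max 1 (4096 * K), by positivity, fun b hb t ht ht' hbt => ?_⟩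
  obtain ⟨hb1, hbK⟩ := max_lt_iff.1 hb
  have hb0 : 0 < b := by linarith
  have sum_bain : ∀ u : ℝ, |u - 1| ≤ 1 / 32 → Summable fun k => exp (-b * dualForm u 1 k) :=
    fun u hu => by
      obtain ⟨h1, h2⟩ := abs_le.1 hu
      have hu0 : 0 < u := by linarith
      refine summable_exp_dualForm hb0 (by linarith) (by norm_num; linarith) ?_
      rw [le_div_iff₀ (by positivity)]
      nlinarith
  have s1 := (sum_bain (1 + t) (by rw [add_sub_cancel_left, abs_of_pos ht]; exact ht')).hasSum
  have s2 := (sum_bain (1 - t) (by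
    rw [sub_sub_cancel_left, abs_neg, abs_of_pos ht]; exact ht')).hasSum
  have s0 := (summable_exp_neg (by norm_num) bccForm_ge hb0).hasSum
  have sR := ((summable_pow_mul_exp_neg (by norm_num) bccForm_ge 2
    (a := 1 / 16) (by norm_num)).hasSum.mul_left
    (32 * b ^ 2 * t ^ 2 * exp (-(13 / 8) * b))).add
    (hasSum_ite_eq ((1, 0, 0) : ℤ × ℤ × ℤ) (-(b * t ^ 2 * exp (-(3 / 2) * b))))
  have h := hasSum_le (bain_term_le hb1.le ht ht' hbt) ((s1.add s2).sub (s0.mul_left 2)) sR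
  rw [← hK] at h
  have hexp : b ^ 2 / 128 ≤ exp (b / 8) := by
    have := quadratic_le_exp_of_nonneg (x := b / 8) (by positivity)
    nlinarith
  have hlt : 32 * b * K < exp (b / 8) := by nlinarith
  have hfin : 32 * b ^ 2 * t ^ 2 * exp (-(13 / 8) * b) * K < b * t ^ 2 * exp (-(3 / 2) * b) := by
    have e : exp (-(3 / 2) * b) = exp (-(13 / 8) * b) * exp (b / 8) := by
      rw [← exp_add]
      ring_nf
    rw [e]
    have : 0 < b * t ^ 2 * exp (-(13 / 8) * b) := by positivity
    nlinarith [mul_lt_mul_of_pos_left hlt this]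
  unfold thetaSum
  linarith

/-- The orthorhombic perturbation of the body-centred-cubic form. -/
theorem dualForm_ortho {u : ℝ} (hu : 0 < u) (k : ℤ × ℤ × ℤ) :
    dualForm u u k = bccForm k + ((u - 1) * (k.1 : ℝ) ^ 2 + (1 / u - 1) * (k.2.1 : ℝ) ^ 2) := by
  simp only [dualForm, bccForm]
  field_simp
  ring

/-- The change of the terms of the theta series along the orthorhombic direction, symmetrised in
`u ↦ 1 / u`. One minimal vector suffices for the gain. -/
theorem ortho_term_ge {b t : ℝ} (hb : 1 ≤ b) (ht : 0 < t) (ht' : t ≤ 1) (k : ℤ × ℤ × ℤ) :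
    -(b * t ^ 2 * exp (3 / 2) * exp (-(3 / 2) * b)) * (bccForm k ^ 1 * exp (-1 * bccForm k))
        + (if k = (1, 0, 0) then b ^ 2 * t ^ 2 / 8 * exp (-(3 / 2) * b) else 0) ≤
      exp (-b * dualForm (1 + t) (1 + t) k) + exp (-b * dualForm (1 / (1 + t)) (1 / (1 + t)) k)
        - 2 * exp (-b * bccForm k) := by
  have hb0 : 0 < b := by linarith
  have hu : 0 < 1 + t := by linarith
  rw [dualForm_ortho hu, dualForm_ortho (by positivity), exp_add_exp_sub, one_div_one_div,
    add_sub_cancel_left, pow_one]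
  have e1 : 1 / (1 + t) - 1 = -(t / (1 + t)) := by
    field_simp
    ring
  have e2 : t - t / (1 + t) = t ^ 2 / (1 + t) := by
    field_simp
    ring
  have e3 : t ^ 2 / (1 + t) ≤ t ^ 2 := div_le_self (sq_nonneg t) (by linarith)
  have e4 : t / 2 ≤ t / (1 + t) := by gcongr; linarith
  rw [e1]
  generalize t / (1 + t) = r at *
  rw [← e2] at e3
  split_ifs with hk
  · subst hk
    have hW : bccForm (1, 0, 0) = 3 / 2 := by norm_num [bccForm]
    rw [hW]
    have g1 := add_one_le_exp (-b * t)
    have g2 := quadratic_le_exp_of_nonneg (x := b * r) (by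
      have : 0 ≤ r := by linarith
      positivity)
    have g3 : b ^ 2 * t ^ 2 / 8 ≤ (b * r) ^ 2 / 2 := by
      have : b * (t / 2) ≤ b * r := by gcongr
      nlinarith [mul_pos hb0 ht]
    have g4 : exp (3 / 2) * exp (-1 * (3 / 2)) = (1 : ℝ) := by
      rw [← exp_add]
      norm_num
    have g5 : exp (-b * (3 / 2)) = exp (-(3 / 2) * b) := by ring_nf
    have g6 : b * t ^ 2 ≥ b * (t - r) := mul_le_mul_of_nonneg_left e3 hb0.le
    rw [g5]
    calc -(b * t ^ 2 * exp (3 / 2) * exp (-(3 / 2) * b)) * (3 / 2 * exp (-1 * (3 / 2)))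
          + b ^ 2 * t ^ 2 / 8 * exp (-(3 / 2) * b)
        = exp (-(3 / 2) * b) * (-(b * t ^ 2) * (3 / 2) * (exp (3 / 2) * exp (-1 * (3 / 2)))
            + b ^ 2 * t ^ 2 / 8) := by ring
      _ ≤ _ := by
        rw [g4]
        refine mul_le_mul_of_nonneg_left ?_ (exp_pos _).le
        norm_num at g1 ⊢
        nlinarith [mul_nonneg hb0.le (sq_nonneg t)]
  · rw [add_zero]
    set W := bccForm k with hW
    have hW0 : 0 ≤ W := bccForm_nonneg k
    have hA : (k.1 : ℝ) ^ 2 + (k.2.1 : ℝ) ^ 2 ≤ W := by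
      rw [hW, bccForm]
      linarith [sq_nonneg (2 * k.2.2 + k.1 + k.2.1 : ℝ)]
    have hA0 : 0 ≤ (k.1 : ℝ) ^ 2 + (k.2.1 : ℝ) ^ 2 := by positivity
    have g1 := add_one_le_exp (-b * (t * (k.1 : ℝ) ^ 2 + -r * (k.2.1 : ℝ) ^ 2))
    have g2 := add_one_le_exp (-b * (-r * (k.1 : ℝ) ^ 2 + t * (k.2.1 : ℝ) ^ 2))
    have g3 : (t - r) * ((k.1 : ℝ) ^ 2 + (k.2.1 : ℝ) ^ 2) ≤ t ^ 2 * W := by gcongr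
    have g4 := mul_le_mul_of_nonneg_left g3 hb0.le
    have g5 : W * exp (-b * W) ≤ exp (3 / 2) * exp (-(3 / 2) * b) * (W * exp (-1 * W)) := by
      have hcase : W = 0 ∨ 3 / 2 ≤ W := by
        rcases bccForm_cases k with h | ⟨h1, h2⟩ | h
        · exact Or.inl h
        · right
          rw [hW, bccForm, h1, h2]
          norm_num
        · right
          linarith
      rcases hcase with h | h
      · simp [h]
      · rw [mul_left_comm, ← exp_add, ← exp_add]
        gcongr
        nlinarith
    calc _ = -(b * t ^ 2) * (exp (3 / 2) * exp (-(3 / 2) * b) * (W * exp (-1 * W))) := by ring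
      _ ≤ -(b * t ^ 2) * (W * exp (-b * W)) := by
        have : 0 ≤ b * t ^ 2 := by positivity
        nlinarith [mul_le_mul_of_nonneg_left g5 this]
      _ = exp (-b * W) * (-(b * (t ^ 2 * W))) := by ring
      _ ≤ _ := by
        refine mul_le_mul_of_nonneg_left ?_ (exp_pos _).le
        linarith

/-- The theta series of a narrow Gaussian has no local maximum at the body-centred-cubic form. -/
theorem exists_lt_thetaSum_ortho : ∃ b₀, 0 < b₀ ∧ ∀ b, b₀ < b → ∀ t, 0 < t → t ≤ 1 / 32 →
    2 * thetaSum b bccForm < thetaSum b (dualForm (1 + t) (1 + t)) +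
      thetaSum b (dualForm (1 / (1 + t)) (1 / (1 + t))) := by
  set K := ∑' k, bccForm k ^ 1 * exp (-1 * bccForm k) with hK
  refine ⟨max 1 (8 * exp (3 / 2) * K), by positivity, fun b hb t ht ht' => ?_⟩
  obtain ⟨hb1, hbK⟩ := max_lt_iff.1 hb
  have hb0 : 0 < b := by linarith
  have sum_ortho : ∀ u : ℝ, 1 / 2 ≤ u → u ≤ 2 → Summable fun k => exp (-b * dualForm u u k) :=
    fun u h1 h2 => by
      have hu0 : 0 < u := by linarith
      refine summable_exp_dualForm hb0 h1 ?_ ?_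
      · rw [le_div_iff₀ (by positivity)]
        nlinarith
      · rw [le_div_iff₀ (by positivity)]
        nlinarith
  have s1 := (sum_ortho (1 + t) (by linarith) (by linarith)).hasSum
  have s2 := (sum_ortho (1 / (1 + t)) (by gcongr; linarith)
    ((div_le_one (by linarith)).2 (by linarith) |>.trans (by norm_num))).hasSum
  have s0 := (summable_exp_neg (by norm_num) bccForm_ge hb0).hasSum
  have sR := ((summable_pow_mul_exp_neg (by norm_num) bccForm_ge 1
    (a := 1) (by norm_num)).hasSum.mul_left
    (-(b * t ^ 2 * exp (3 / 2) * exp (-(3 / 2) * b)))).add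
    (hasSum_ite_eq ((1, 0, 0) : ℤ × ℤ × ℤ) (b ^ 2 * t ^ 2 / 8 * exp (-(3 / 2) * b)))
  have h := hasSum_le (ortho_term_ge hb1.le ht (by linarith)) sR
    ((s1.add s2).sub (s0.mul_left 2))
  rw [← hK] at h
  have hfin : b * t ^ 2 * exp (3 / 2) * exp (-(3 / 2) * b) * K <
      b ^ 2 * t ^ 2 / 8 * exp (-(3 / 2) * b) := by
    have : 0 < b * t ^ 2 * exp (-(3 / 2) * b) / 8 := by positivity
    nlinarith [mul_lt_mul_of_pos_left hbK this]
  unfold thetaSum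
  linarith

/-! ### The saddle point -/

theorem bravaisEnergy_eq_dualForm {α u v : ℝ} (hα : 0 < α)
    (hq : ![u, v, 0, 1 / 2, 1 / 2] ∈ bravaisDomain)
    (hs : ‖fccStrain ![u, v, 0, 1 / 2, 1 / 2]‖ ≤ 1 / 12) (h1 : 1 / 2 ≤ u) (h2 : 1 / 2 ≤ u / v ^ 2)
    (h3 : 1 / 4 ≤ v ^ 2 / (2 * u ^ 2)) :
    bravaisEnergy (gaussPotential α) 1 ![u, v, 0, 1 / 2, 1 / 2] =
      √(2 * (π / (α * scaleConst 1)) ^ 3) *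
        thetaSum (π ^ 2 / (α * scaleConst 1)) (dualForm u v) - 1 := by
  have ha := mul_pos hα scaleConst_one_pos
  rw [bravaisEnergy_eq_of_norm_le hq hs hα,
    thetaSum_eq_mul_thetaSum_dualForm ha (show 0 < u from hq.1) (show 0 < v from hq.2)]
  · refine summable_exp_neg (c := 1 / 8) (by norm_num) (fun n => ?_) ha
    rw [bravaisForm_eq_add_strainForm hq]
    exact fccForm_add_strainForm_ge hs n
  · exact summable_exp_dualForm (by positivity) h1 h2 h3

/-- A property of the parameters near `D₃` holds along every curve `(u, v, 0, 1/2, 1/2)` through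
`D₃`, together with the conditions under which Poisson summation applies. -/
theorem eventually_of_nhds_fccParam {P : (Fin 5 → ℝ) → Prop}
    (hP : ∀ᶠ q in 𝓝[bravaisDomain] fccParam, P q) {α : ℝ} (hα : 0 < α) {u v : ℝ → ℝ}
    (hu : ContinuousAt u 0) (hv : ContinuousAt v 0) (hu0 : u 0 = 1) (hv0 : v 0 = 1) :
    ∀ᶠ t in 𝓝[>] (0 : ℝ), P ![u t, v t, 0, 1 / 2, 1 / 2] ∧
      bravaisEnergy (gaussPotential α) 1 ![u t, v t, 0, 1 / 2, 1 / 2] =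
      √(2 * (π / (α * scaleConst 1)) ^ 3) *
        thetaSum (π ^ 2 / (α * scaleConst 1)) (dualForm (u t) (v t)) - 1 := by
  have hγ : Tendsto (fun t => ![u t, v t, 0, 1 / 2, 1 / 2]) (𝓝 0) (𝓝 fccParam) := by
    have h : ContinuousAt (fun t => ![u t, v t, 0, 1 / 2, 1 / 2]) 0 := by
      rw [continuousAt_pi]
      intro i
      fin_cases i <;> simp <;> first | assumption | exact continuousAt_const
    have h' := h.tendsto
    rwa [hu0, hv0] at h'
  have c2 : ∀ᶠ t in 𝓝 (0 : ℝ), 1 / 2 < u t :=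
    hu.eventually (lt_mem_nhds (by rw [hu0]; norm_num))
  have c3 : ∀ᶠ t in 𝓝 (0 : ℝ), 1 / 2 < u t / v t ^ 2 :=
    (hu.div (hv.pow 2) (by simp [hv0])).eventually (lt_mem_nhds (by norm_num [hu0, hv0]))
  have c4 : ∀ᶠ t in 𝓝 (0 : ℝ), 1 / 4 < v t ^ 2 / (2 * u t ^ 2) :=
    ((hv.pow 2).div ((continuousAt_const (y := (2 : ℝ))).mul (hu.pow 2))
      (by simp [hu0])).eventually (lt_mem_nhds (by norm_num [hu0, hv0]))
  refine Eventually.filter_mono nhdsWithin_le_nhds ?_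
  filter_upwards [hγ.eventually (eventually_mem_bravaisDomain fccParam_mem),
    hγ.eventually (eventually_norm_fccStrain_le (ε := 1 / 12) (by norm_num)),
    hγ.eventually (eventually_nhdsWithin_iff.1 hP), c2, c3, c4] with t h1 h2 h3 h4 h5 h6
  exact ⟨h3 h1, bravaisEnergy_eq_dualForm hα h1 h2 h4.le h5.le h6.le⟩

theorem bravaisEnergy_fccParam_eq_bccForm {α : ℝ} (hα : 0 < α) :
    bravaisEnergy (gaussPotential α) 1 fccParam = √(2 * (π / (α * scaleConst 1)) ^ 3) *
      thetaSum (π ^ 2 / (α * scaleConst 1)) bccForm - 1 := by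
  rw [← dualForm_one_one]
  refine bravaisEnergy_eq_dualForm hα fccParam_mem ?_ (by norm_num) (by norm_num) (by norm_num)
  have : fccStrain ![1, 1, 0, 1 / 2, 1 / 2] = 0 := fccStrain_fccParam
  rw [this]
  norm_num

theorem not_isLocalMinLattice_fccParam {α : ℝ} (hα : 0 < α) {b : ℝ}
    (hb : b = π ^ 2 / (α * scaleConst 1))
    (h : ∀ t, 0 < t → t ≤ 1 / 32 → b * t ^ 2 ≤ 1 →
      thetaSum b (dualForm (1 + t) 1) + thetaSum b (dualForm (1 - t) 1) < 2 * thetaSum b bccForm) :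
    ¬ IsLocalMinLattice (gaussPotential α) 1 fccParam := by
  rintro ⟨-, hmin⟩
  have hC := scaleConst_one_pos
  have e1 := eventually_of_nhds_fccParam hmin hα (u := fun t => 1 + t) (v := fun _ => 1)
    (by fun_prop) (by fun_prop) (by simp) rfl
  have e2 := eventually_of_nhds_fccParam hmin hα (u := fun t => 1 - t) (v := fun _ => 1)
    (by fun_prop) (by fun_prop) (by simp) rfl
  have e3 : ∀ᶠ t in 𝓝[>] (0 : ℝ), t < 1 / 32 ∧ b * t ^ 2 < 1 := by
    refine Eventually.filter_mono nhdsWithin_le_nhds ((gt_mem_nhds (by norm_num)).and ?_)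
    have : ContinuousAt (fun t : ℝ => b * t ^ 2) 0 := by fun_prop
    exact this.eventually (gt_mem_nhds (by norm_num))
  obtain ⟨t, ⟨h1, h1'⟩, ⟨h2, h2'⟩, ⟨h3, h3'⟩, ht⟩ :=
    (e1.and (e2.and (e3.and self_mem_nhdsWithin))).exists
  rw [bravaisEnergy_fccParam_eq_bccForm hα, ← hb] at h1 h2
  rw [h1', ← hb] at h1
  rw [h2', ← hb] at h2
  have hκ : 0 < √(2 * (π / (α * scaleConst 1)) ^ 3) := sqrt_pos.2 (by positivity)
  nlinarith [mul_lt_mul_of_pos_left (h t ht h3.le h3'.le) hκ]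

theorem not_isLocalMaxLattice_fccParam {α : ℝ} (hα : 0 < α) {b : ℝ}
    (hb : b = π ^ 2 / (α * scaleConst 1))
    (h : ∀ t, 0 < t → t ≤ 1 / 32 → 2 * thetaSum b bccForm <
      thetaSum b (dualForm (1 + t) (1 + t)) + thetaSum b (dualForm (1 / (1 + t)) (1 / (1 + t)))) :
    ¬ IsLocalMaxLattice (gaussPotential α) 1 fccParam := by
  rintro ⟨-, hmax⟩
  have hC := scaleConst_one_pos
  have hinv : ContinuousAt (fun t : ℝ => 1 / (1 + t)) 0 :=
    continuousAt_const.div (by fun_prop) (by norm_num)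
  have e1 := eventually_of_nhds_fccParam hmax hα (u := fun t => 1 + t) (v := fun t => 1 + t)
    (by fun_prop) (by fun_prop) (by simp) (by simp)
  have e2 := eventually_of_nhds_fccParam hmax hα (u := fun t => 1 / (1 + t))
    (v := fun t => 1 / (1 + t)) hinv hinv (by simp) (by simp)
  have e3 : ∀ᶠ t in 𝓝[>] (0 : ℝ), t < 1 / 32 :=
    Eventually.filter_mono nhdsWithin_le_nhds (gt_mem_nhds (by norm_num))
  obtain ⟨t, ⟨h1, h1'⟩, ⟨h2, h2'⟩, h3, ht⟩ :=
    (e1.and (e2.and (e3.and self_mem_nhdsWithin))).exists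
  rw [bravaisEnergy_fccParam_eq_bccForm hα, ← hb] at h1 h2
  rw [h1', ← hb] at h1
  rw [h2', ← hb] at h2
  have hκ : 0 < √(2 * (π / (α * scaleConst 1)) ^ 3) := sqrt_pos.2 (by positivity)
  nlinarith [mul_lt_mul_of_pos_left (h t ht h3.le) hκ]

theorem proposition5p3 :
    ∃ α₀ α₁ : ℝ, 0 < α₀ ∧ 0 < α₁ ∧
      (∀ α : ℝ, 0 < α → α < α₀ → IsSaddleLattice (gaussPotential α) 1 fccParam) ∧
      (∀ α : ℝ, α₁ < α → IsLocalMinLattice (gaussPotential α) 1 fccParam) := by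
  obtain ⟨α₁, hα₁, hmin⟩ := exists_isLocalMinLattice_fccParam
  obtain ⟨b, hb, hneg⟩ := exists_thetaSum_bain_lt
  obtain ⟨b', hb', hpos⟩ := exists_lt_thetaSum_ortho
  have hC := scaleConst_one_pos
  have hm : 0 < max b b' := lt_max_of_lt_left hb
  refine ⟨π ^ 2 / (max b b' * scaleConst 1), α₁, by positivity, hα₁, fun α hα hlt => ?_, hmin⟩
  have hB : max b b' < π ^ 2 / (α * scaleConst 1) := by
    rw [lt_div_iff₀ (by positivity)] at hlt ⊢
    linarith
  obtain ⟨h1, h2⟩ := max_lt_iff.1 hB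
  exact ⟨isCriticalLattice_fccParam hα, not_isLocalMinLattice_fccParam hα rfl (hneg _ h1),
    not_isLocalMaxLattice_fccParam hα rfl (hpos _ h2)⟩
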